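/- Let $a<b$, $S=[a,b]$, $n\ge 1$, $r\ge 1$, $\nu\ge 1$, $s>0$. For $1\le p\le n$ let $\theta_p:S\to S$ and $g_p:S\to[0,\infty)$ be functions of class $C^{r+1}$, with $g_p$ not identically zero. Assume there are $M_0>0$, $C_0\ge 1$ and $0<\kappa<1$ such that $g_p(t_1)\le g_p(t_2)\exp(M_0|t_1-t_2|)$ for all $p$ and all $t_1,t_2\in S$, and $|\theta_\omega(t_1)-\theta_\omega(t_2)|\le C_0\kappa^{k}|t_1-t_2|$ for all $k\ge 1$, all $\omega=(p_1,\dots,p_k)\in\{1,\dots,n\}^k$ and all $t_1,t_2\in S$, where $\theta_\omega=\theta_{p_1}\circ\cdots\circ\theta_{p_k}$. Put $g_\omega(t)=\prod_{j=1}^{k} g_{p_j}(\theta_{p_{j+1}}\circ\cdots\circ\theta_{p_k}(t))$. Let $L_s:C(S)\to C(S)$, $(L_sf)(t)=\sum_{p=1}^n g_p(t)^s f(\theta_p(t))$, and let $\lambda_s=R(L_s)$, where $R$ denotes the spectral radius. Let $v_s\in C^{r+1}(S)$ be the strictly positive eigenfunction of $L_s$ with eigenvalue $\lambda_s$ (it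 exists and is unique up to a positive factor). Let $[a_i,b_i]\subset S$, $1\le i\le I$, be intervals with $a_i<b_i$ and $b_i<a_{i+1}$, such that for every $\omega\in\{1,\dots,n\}^\nu$ there is an $i$ with $\theta_\omega(S)\subset[a_i,b_i]$. Divide $[a_i,b_i]$ into $N_i\ge 1$ equal subintervals of length $h_i=(b_i-a_i)/N_i$, and let $c^i_{j,k}=a_i+(j-1)h_i+\tfrac{h_i}{2}(1+\hat c_k)$, $1\le j\le N_i$, $0\le k\le r$, with the extended Chebyshev points $\hat c_k=-\cos\big(\tfrac{2k+1}{2r+2}\pi\big)/\cos\big(\tfrac{\pi}{2r+2}\big)$. Let $T$ be the finite set of all $c^i_{j,k}$, and put $h=\max_i h_i$, $h_{\min}=\min_i h_i$, $\mu=h/h_{\min}$. For $F:T\to\mathbb R$ let $\mathcal F$ be the continuous function on $\bigcup_i[a_i,b_i]$ that on each subinterval $[a_i+(j-1)h_i,a_i+jh_i]$ is the polynomial of degree $\le r$ which agrees with $F$ at the points $c^i_{j,0},\dots,c^i_{j,r}$, and let $$(\mathbf L_{s,\nu}F)(\xi)=\sum_{\omega\in\{1,\dots,n\}^\nu} g_\omega(\xi)^s\,\mathcal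 F(\theta_\omega(\xi)),\qquad \xi\in T,$$ a linear map of $\mathbb R^T$ into itself. For $M>0$ let $K(M;T)=\{F:T\to\mathbb R:\ F(\xi)\le e^{M|\xi-\eta|}F(\eta)\ \text{for all }\xi,\eta\in T\}$. Let $E$ and $\chi>0$ be constants with $$\sup_{x\in S}\frac{|v_s^{(r+1)}(x)|}{v_s(x)}\le E,\qquad v_s(x_1)\le v_s(x_2)\,e^{2s|x_1-x_2|/\chi}\quad(x_1,x_2\in S),$$ and put $$G=E\,e^{2sh/\chi}\,\frac{1}{(r+1)!}\Big[\frac{1}{2\cos(\pi/(2r+2))}\Big]^{r+1}\frac{1}{2^r},$$ $$M_1=\mu\,\frac{Gh^r}{1-G^2h^{2r+2}}\,\frac{1}{\sin^2(\pi/(2r+2))}+\frac{2s}{\chi},\qquad M_2=M_1+\frac GH\cdot\frac{\mu}{1-[(G/H)h]^2}\cdot\frac{1}{\sin^2(\pi/(2r+2))},$$ where $H>G$ is a constant. Assume that $h<1$, that $Gh^{r+1}<1$, that $2\sin^2(\pi/(2r+2))\,h_i\le a_{i+1}-b_i$ for $1\le i<I$, and that $\mathbf L_{s,\nu}(K(M;T))\subset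 K(M';T)$ for some $0<M'<M$ with $M\ge M_2$. Then $$\lambda_s^\nu(1-Hh^r)\le R(\mathbf L_{s,\nu})\le\lambda_s^\nu(1+Hh^r).$$ -/

import Mathlib

noncomputable section

/-! ## The iterated function system and its transfer operator -/

/-- An iterated function system `θ_1, …, θ_n` on `S = [a, b]` together with weights `g_1, …, g_n`.
The maps are Lipschitz self-maps of `S`; the weights are nonnegative, continuous and not
identically zero on `S`, and satisfy `g_p(t₁) ≤ g_p(t₂) exp(M₀ |t₁ - t₂|)` for a common `M₀ > 0`.
Values outside `[a, b]` play no role. -/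
structure WeightedIFS (a b : ℝ) (n : ℕ) where
  θ : Fin n → ℝ → ℝ
  g : Fin n → ℝ → ℝ
  mapsTo : ∀ p, Set.MapsTo (θ p) (Set.Icc a b) (Set.Icc a b)
  lipschitz : ∀ p, ∃ C : NNReal, LipschitzOnWith C (θ p) (Set.Icc a b)
  nonneg : ∀ p, ∀ t ∈ Set.Icc a b, 0 ≤ g p t
  continuousOn : ∀ p, ContinuousOn (g p) (Set.Icc a b)
  not_zero : ∀ p, ∃ t ∈ Set.Icc a b, g p t ≠ 0
  log_lipschitz : ∃ M₀ : ℝ, 0 < M₀ ∧ ∀ p, ∀ t₁ ∈ Set.Icc a b, ∀ t₂ ∈ Set.Icc a b,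
    g p t₁ ≤ g p t₂ * Real.exp (M₀ * |t₁ - t₂|)

namespace WeightedIFS

variable {a b : ℝ} {n : ℕ} (Φ : WeightedIFS a b n)

theorem g_pos (p : Fin n) {t : ℝ} (ht : t ∈ Set.Icc a b) : 0 < Φ.g p t := by
  obtain ⟨M₀, -, h⟩ := Φ.log_lipschitz
  obtain ⟨u, hu, hne⟩ := Φ.not_zero p
  have h1 : 0 < Φ.g p u := lt_of_le_of_ne (Φ.nonneg p u hu) (Ne.symm hne)
  exact pos_of_mul_pos_left (lt_of_lt_of_le h1 (h p u hu t ht)) (Real.exp_pos _).le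

/-- `θ_p` as a continuous self-map of the compact space `[a, b]`. -/
def thetaMap (p : Fin n) : C(Set.Icc a b, Set.Icc a b) where
  toFun t := ⟨Φ.θ p t, Φ.mapsTo p t.2⟩
  continuous_toFun := by
    obtain ⟨C, hC⟩ := Φ.lipschitz p
    exact (continuousOn_iff_continuous_domRestrict.mp hC.continuousOn).subtype_mk _

/-- The function `t ↦ g_p(t)^s` in `C([a, b], 𝕜)`. -/
def weight (𝕜 : Type*) [RCLike 𝕜] (s : ℝ) (p : Fin n) : C(Set.Icc a b, 𝕜) where
  toFun t := ((Φ.g p t ^ s : ℝ) : 𝕜)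
  continuous_toFun := RCLike.continuous_ofReal.comp
    ((continuousOn_iff_continuous_domRestrict.mp (Φ.continuousOn p)).rpow_const
      fun t => Or.inl (Φ.g_pos p t.2).ne')

/-- The transfer operator `(L_s f)(t) = ∑_p g_p(t)^s f(θ_p(t))` on `C([a, b], 𝕜)`. For `𝕜 = ℝ` it
is the real Perron-Frobenius operator `L_s`, and for `𝕜 = ℂ` it is its complexification. -/
def transferOp (𝕜 : Type*) [RCLike 𝕜] (s : ℝ) : C(Set.Icc a b, 𝕜) →L[𝕜] C(Set.Icc a b, 𝕜) where
  toFun f := ∑ p, Φ.weight 𝕜 s p * f.comp (Φ.thetaMap p)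
  map_add' f f' := by
    rw [← Finset.sum_add_distrib]
    exact Finset.sum_congr rfl fun p _ => by rw [ContinuousMap.add_comp, mul_add]
  map_smul' c f := by
    rw [RingHom.id_apply, Finset.smul_sum]
    exact Finset.sum_congr rfl fun p _ => by rw [ContinuousMap.smul_comp, mul_smul_comm]
  cont := continuous_finsetSum _ fun p _ =>
    continuous_const.mul (ContinuousMap.continuous_precomp (Φ.thetaMap p))

theorem transferOp_apply (𝕜 : Type*) [RCLike 𝕜] (s : ℝ) (f : C(Set.Icc a b, 𝕜))
    (t : Set.Icc a b) :
    Φ.transferOp 𝕜 s f t = ∑ p, ((Φ.g p t ^ s : ℝ) : 𝕜) * f (Φ.thetaMap p t) := by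
  change (∑ p, Φ.weight 𝕜 s p * f.comp (Φ.thetaMap p)) t = _
  rw [ContinuousMap.sum_apply]
  rfl

/-- `λ_s = R(L_s)`, the spectral radius of `L_s` (the spectrum of a real operator is the spectrum
of its complexification). -/
def lam (s : ℝ) : ℝ := (spectralRadius ℂ (Φ.transferOp ℂ s)).toReal

/-- `θ_ω = θ_{p₁} ∘ ⋯ ∘ θ_{p_ν}` for a word `ω = (p₁, …, p_ν)`. -/
def thetaWord : List (Fin n) → ℝ → ℝ
  | [], t => t
  | p :: w, t => Φ.θ p (thetaWord w t)

/-- `g_ω(t) = g_{p₁}(θ_{p₂} ∘ ⋯ ∘ θ_{p_ν}(t)) ⋯ g_{p_{ν-1}}(θ_{p_ν}(t)) g_{p_ν}(t)`. -/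
def gWord : List (Fin n) → ℝ → ℝ
  | [], _ => 1
  | p :: w, t => Φ.g p (Φ.thetaWord w t) * gWord w t

/-- The uniform contraction hypothesis on the iterates: there are `C₀ ≥ 1` and `0 < κ < 1` with
`|θ_ω(t₁) - θ_ω(t₂)| ≤ C₀ κ^ν |t₁ - t₂|` for all `ν ≥ 1`, all words `ω` of length `ν` and all
`t₁, t₂ ∈ [a, b]`. -/
def EventuallyContracting : Prop :=
  ∃ C₀ κ : ℝ, 1 ≤ C₀ ∧ 0 < κ ∧ κ < 1 ∧
    ∀ ν : ℕ, 1 ≤ ν → ∀ ω : Fin ν → Fin n, ∀ t₁ ∈ Set.Icc a b, ∀ t₂ ∈ Set.Icc a b,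
      |Φ.thetaWord (List.ofFn ω) t₁ - Φ.thetaWord (List.ofFn ω) t₂| ≤ C₀ * κ ^ ν * |t₁ - t₂|

/-- `v` is a strictly positive eigenfunction of `L_s` of class `C^m` on `[a, b]`, with eigenvalue
`λ_s = R(L_s)`. -/
def IsPosEigenfunction (s : ℝ) (m : ℕ) (v : ℝ → ℝ) : Prop :=
  ContDiffOn ℝ m v (Set.Icc a b) ∧ (∀ x ∈ Set.Icc a b, 0 < v x) ∧
    ∀ x ∈ Set.Icc a b, ∑ p, Φ.g p x ^ s * v (Φ.θ p x) = Φ.lam s * v x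

end WeightedIFS

/-! ## The mesh and piecewise polynomial interpolation -/

/-- Ordered, pairwise disjoint, nondegenerate compact intervals `[a_i, b_i]`, `i < I`, the `i`-th
one being subdivided into `N_i ≥ 1` equal subintervals. -/
structure IntervalMesh (I : ℕ) where
  left : Fin I → ℝ
  right : Fin I → ℝ
  N : Fin I → ℕ
  left_lt_right : ∀ i, left i < right i
  N_pos : ∀ i, 0 < N i
  ordered : ∀ i i', i < i' → right i < left i'

/-- The `k`-th extended Chebyshev point of degree `r` in `[-1, 1]`, `0 ≤ k ≤ r`. -/
def chebPoint (r : ℕ) (k : Fin (r + 1)) : ℝ :=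
  -Real.cos ((2 * (k : ℝ) + 1) / (2 * r + 2) * Real.pi) / Real.cos (Real.pi / (2 * r + 2))

namespace IntervalMesh

variable {I : ℕ} (𝓜 : IntervalMesh I)

/-- `h_i = (b_i - a_i) / N_i`. -/
def width (i : Fin I) : ℝ := (𝓜.right i - 𝓜.left i) / 𝓜.N i

/-- `h = max_i h_i`. -/
def h : ℝ := ⨆ i, 𝓜.width i

/-- `h_min = min_i h_i`. -/
def hmin : ℝ := ⨅ i, 𝓜.width i

/-- `μ = h / h_min`. -/
def mu : ℝ := 𝓜.h / 𝓜.hmin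

/-- The interpolation point with index `k` in the `j`-th subinterval of `[a_i, b_i]`. Here `j`
is counted from `0`, so that this subinterval is `[a_i + j h_i, a_i + (j + 1) h_i]`. -/
def node (r : ℕ) (i : Fin I) (j : Fin (𝓜.N i)) (k : Fin (r + 1)) : ℝ :=
  𝓜.left i + (j : ℝ) * 𝓜.width i + 𝓜.width i * (1 + chebPoint r k) / 2

/-- The finite set `T` of all interpolation points. -/
def T (r : ℕ) : Finset ℝ :=
  Finset.univ.image fun q : (i : Fin I) × Fin (𝓜.N i) × Fin (r + 1) =>
    𝓜.node r q.1 q.2.1 q.2.2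

theorem node_mem_T (r : ℕ) (i : Fin I) (j : Fin (𝓜.N i)) (k : Fin (r + 1)) :
    𝓜.node r i j k ∈ 𝓜.T r :=
  Finset.mem_image.mpr ⟨⟨i, j, k⟩, Finset.mem_univ _, rfl⟩

/-- The (0-based) index of a subinterval of `[a_i, b_i]` containing `x ∈ [a_i, b_i]`. -/
def cell (i : Fin I) (x : ℝ) : Fin (𝓜.N i) :=
  ⟨min ⌊(x - 𝓜.left i) / 𝓜.width i⌋₊ (𝓜.N i - 1), by have := 𝓜.N_pos i; omega⟩

/-- The continuous piecewise polynomial of degree `≤ r` on `⋃ i, [a_i, b_i]` interpolating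
`F : T → ℝ` at the points of `T` (and `0` outside of this union): on each subinterval it is
`∑_k l_{j,k}^i(x) F(c_{j,k}^i)`, with the Lagrange basis polynomials `l_{j,k}^i`. Since the
intervals are disjoint, at most one term of the sum over `i` is nonzero. -/
def interp (r : ℕ) (F : 𝓜.T r → ℝ) (x : ℝ) : ℝ :=
  open Classical in
  ∑ i, if x ∈ Set.Icc (𝓜.left i) (𝓜.right i) then
    ∑ k, (Lagrange.basis Finset.univ (𝓜.node r i (𝓜.cell i x)) k).eval x *
      F ⟨𝓜.node r i (𝓜.cell i x) k, 𝓜.node_mem_T r i (𝓜.cell i x) k⟩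
  else 0

theorem interp_add (r : ℕ) (F F' : 𝓜.T r → ℝ) (x : ℝ) :
    𝓜.interp r (F + F') x = 𝓜.interp r F x + 𝓜.interp r F' x := by
  classical
  unfold interp
  rw [← Finset.sum_add_distrib]
  refine Finset.sum_congr rfl fun i _ => ?_
  split_ifs
  · rw [← Finset.sum_add_distrib]
    exact Finset.sum_congr rfl fun k _ => by rw [Pi.add_apply, mul_add]
  · simp

theorem interp_smul (r : ℕ) (c : ℝ) (F : 𝓜.T r → ℝ) (x : ℝ) :
    𝓜.interp r (c • F) x = c * 𝓜.interp r F x := by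
  classical
  unfold interp
  rw [Finset.mul_sum]
  refine Finset.sum_congr rfl fun i _ => ?_
  split_ifs
  · rw [Finset.mul_sum]
    exact Finset.sum_congr rfl fun k _ => by rw [Pi.smul_apply, smul_eq_mul]; ring
  · simp

/-- The cone `K(M; T)` of all `F : T → ℝ` with `F(ξ) ≤ exp(M |ξ - η|) F(η)` for `ξ, η ∈ T`. -/
def cone (r : ℕ) (M : ℝ) : Set (𝓜.T r → ℝ) :=
  {F | ∀ ξ η : 𝓜.T r, F ξ ≤ Real.exp (M * |(ξ : ℝ) - η|) * F η}

end IntervalMesh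

/-! ## The discrete operator and the constants -/

/-- For every word `ω` of length `ν`, `θ_ω([a, b])` lies in one of the intervals `[a_i, b_i]`, and
these intervals lie in `[a, b]`. -/
def MeshAbsorbs {a b : ℝ} {n I : ℕ} (Φ : WeightedIFS a b n) (𝓜 : IntervalMesh I) (ν : ℕ) : Prop :=
  (∀ i, Set.Icc (𝓜.left i) (𝓜.right i) ⊆ Set.Icc a b) ∧
    ∀ ω : Fin ν → Fin n, ∃ i,
      Set.MapsTo (Φ.thetaWord (List.ofFn ω)) (Set.Icc a b) (Set.Icc (𝓜.left i) (𝓜.right i))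

/-- The operator `𝐋_{s,ν}` on functions `F : T → ℝ`:
`(𝐋_{s,ν} F)(ξ) = ∑_ω g_ω(ξ)^s 𝓕(θ_ω(ξ))`, where `ω` runs over the words of length `ν` and `𝓕` is
the piecewise polynomial interpolant of `F`. -/
def discreteOp {a b : ℝ} {n I : ℕ} (Φ : WeightedIFS a b n) (𝓜 : IntervalMesh I)
    (r : ℕ) (s : ℝ) (ν : ℕ) : (𝓜.T r → ℝ) →ₗ[ℝ] (𝓜.T r → ℝ) where
  toFun F ξ := ∑ ω : Fin ν → Fin n,
    Φ.gWord (List.ofFn ω) ξ ^ s * 𝓜.interp r F (Φ.thetaWord (List.ofFn ω) ξ)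
  map_add' F F' := by
    funext ξ
    simp only [IntervalMesh.interp_add, Pi.add_apply, mul_add, Finset.sum_add_distrib]
  map_smul' c F := by
    funext ξ
    simp only [IntervalMesh.interp_smul, Pi.smul_apply, smul_eq_mul, RingHom.id_apply,
      Finset.mul_sum]
    exact Finset.sum_congr rfl fun ω _ => by ring

/-- `R(A)` for a linear map `A` of `ℝ^ι`: the spectral radius of the matrix of `A`, over `ℂ`. -/
def matrixSpectralRadius {ι : Type*} [Fintype ι] [DecidableEq ι]
    (A : (ι → ℝ) →ₗ[ℝ] (ι → ℝ)) : ℝ :=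
  (spectralRadius ℂ ((LinearMap.toMatrix' A).map (algebraMap ℝ ℂ))).toReal

/-- The constant
`G_{r+1} = E exp(2 s h / χ) (1 / (r+1)!) (1 / (2 cos(π / (2r+2))))^{r+1} (1 / 2^r)`. -/
def constG (r : ℕ) (s E χ h : ℝ) : ℝ :=
  E * Real.exp (2 * s * h / χ) * (1 / ((r + 1).factorial : ℝ)) *
    (1 / (2 * Real.cos (Real.pi / (2 * r + 2)))) ^ (r + 1) * (1 / 2 ^ r)

/-- The constant `M₁ = μ (G h^r / (1 - G² h^{2r+2})) (1 / sin(π / (2r+2)))² + 2 s / χ`. -/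
def constM₁ (r : ℕ) (s χ h μ G : ℝ) : ℝ :=
  μ * (G * h ^ r / (1 - G ^ 2 * h ^ (2 * r + 2))) * (1 / Real.sin (Real.pi / (2 * r + 2))) ^ 2 +
    2 * s / χ

/-- The constant `M₂ = M₁ + (G / H) (μ / (1 - ((G / H) h)²)) (1 / sin(π / (2r+2))²)`. -/
def constM₂ (r : ℕ) (s χ h μ G H : ℝ) : ℝ :=
  constM₁ r s χ h μ G +
    G / H * (μ / (1 - (G / H * h) ^ 2)) * (1 / Real.sin (Real.pi / (2 * r + 2)) ^ 2)

end

noncomputable section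

open Filter Topology

/-! ## Gelfand's formula and power bounds -/

section Gelfand

variable {A : Type*} [NormedRing A] [NormedAlgebra ℂ A] [CompleteSpace A]

/-! Let `V` be the restriction of the eigenfunction `v` to the mesh points, `A` the discrete
operator and `Λ = λ_s ^ ν`. Iterating the eigenvalue equation writes `Λ v` as a sum over words of
length `ν`, and `A V` differs from it only by interpolation errors. The remainder formula at
extended Chebyshev points, with the bounds on `v`, gives `|A V - Λ V| ≤ G h^(r+1) Λ V`
(`abs_discreteOp_sub_le`).

Hence `Λ (1 + H h^r) V - A V` and `A V - Λ (1 - H h^r) V` are both perturbations of `Λ H h^r V` of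
relative size `ε = (G / H) h`. On points separated by `δ = 2 sin² h_min` such a perturbation costs
only `2 ε / ((1 - ε²) δ)` in the logarithmic Lipschitz constant, so both lie in `K(M; T)` as soon as
`M ≥ M₂` (`mem_cone_of_abs_sub_le`). The cone is invariant under `A` and its elements are
nonnegative. Telescoping gives `A^k V ≥ c^k V` for `c = Λ (1 - H h^r)`, when `c ≥ 0`, and `A^k V ≤
c^k V` for `c = Λ (1 + H h^r)`; Gelfand's formula turns these into bounds on the spectral radius.
The upper bound also needs every unit vector to be dominated in the cone order by a multiple of `V`,
which comes from the strict inclusion `M' < M`.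

The estimates on `v` are assumed for all positive eigenfunctions of class `C^(r+1)`, so one has to
be produced. Bounded distortion makes `L_s^k 1` comparable to `λ_s^k`, and limits of Cesàro means
give a continuous eigenfunction (`exists_continuous_eigenfunction`). Its smoothness is a bootstrap:
the formal derivative solves an equation of the same type with contracting iterates
(`contDiffOn_of_eq_weightedComp_add`). -/

theorem spectralRadius_ne_top (a : A) : spectralRadius ℂ a ≠ ⊤ := by
  have h := spectrum.spectralRadius_le_pow_nnnorm_pow_one_div ℂ a 0
  refine ne_top_of_le_ne_top ?_ h
  simp [ENNReal.mul_ne_top]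

theorem tendsto_norm_pow_rpow_spectralRadius (a : A) :
    Tendsto (fun k : ℕ => ‖a ^ k‖ ^ (1 / k : ℝ)) atTop (𝓝 (spectralRadius ℂ a).toReal) := by
  have h := (ENNReal.tendsto_toReal (spectralRadius_ne_top a)).comp
    (spectrum.pow_norm_pow_one_div_tendsto_nhds_spectralRadius a)
  refine h.congr fun k => ?_
  exact ENNReal.toReal_ofReal (by positivity)

theorem tendsto_const_rpow_one_div {c : ℝ} (hc : 0 < c) :
    Tendsto (fun k : ℕ => c ^ (1 / k : ℝ)) atTop (𝓝 1) := by
  have h : Tendsto (fun k : ℕ => (1 / k : ℝ)) atTop (𝓝 0) := tendsto_one_div_atTop_nhds_zero_nat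
  simpa [Function.comp_def] using (Real.continuousAt_const_rpow hc.ne').tendsto.comp h

/-- A frequent exponential lower bound for the norms of the powers of `a` bounds the spectral
radius of `a` from below. -/
theorem le_spectralRadius_of_frequently {a : A} {c x : ℝ} (hc : 0 < c) (hx : 0 ≤ x)
    (h : ∃ᶠ k : ℕ in atTop, c * x ^ k ≤ ‖a ^ k‖) : x ≤ (spectralRadius ℂ a).toReal := by
  have h1 : Tendsto (fun k : ℕ => c ^ (1 / k : ℝ) * x) atTop (𝓝 x) := by
    simpa using (tendsto_const_rpow_one_div hc).mul_const x
  refine le_of_tendsto_of_tendsto_of_frequently h1 (tendsto_norm_pow_rpow_spectralRadius a) ?_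
  refine (h.and_eventually (eventually_ge_atTop 1)).mono fun k hk => ?_
  have hk0 : k ≠ 0 := by have := hk.2; omega
  calc c ^ (1 / k : ℝ) * x = (c * x ^ k) ^ (1 / k : ℝ) := by
        rw [Real.mul_rpow hc.le (by positivity), one_div, Real.pow_rpow_inv_natCast hx hk0]
    _ ≤ _ := Real.rpow_le_rpow (by positivity) hk.1 (by positivity)

/-- An exponential upper bound for the norms of the powers of `a` bounds the spectral radius of
`a` from above. -/
theorem spectralRadius_le_of_forall {a : A} {c x : ℝ} (hc : 0 < c) (hx : 0 ≤ x)
    (h : ∀ k : ℕ, ‖a ^ k‖ ≤ c * x ^ k) : (spectralRadius ℂ a).toReal ≤ x := by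
  have h1 : Tendsto (fun k : ℕ => c ^ (1 / k : ℝ) * x) atTop (𝓝 x) := by
    simpa using (tendsto_const_rpow_one_div hc).mul_const x
  refine le_of_tendsto_of_tendsto (tendsto_norm_pow_rpow_spectralRadius a) h1 ?_
  filter_upwards [eventually_ge_atTop 1] with k hk
  have hk0 : k ≠ 0 := by omega
  calc _ ≤ (c * x ^ k) ^ (1 / k : ℝ) :=
        Real.rpow_le_rpow (norm_nonneg _) (h k) (by positivity)
    _ = c ^ (1 / k : ℝ) * x := by
        rw [Real.mul_rpow hc.le (by positivity), one_div, Real.pow_rpow_inv_natCast hx hk0]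

theorem spectralRadius_pow_le_norm_pow [NormOneClass A] (a : A) (k : ℕ) :
    (spectralRadius ℂ a).toReal ^ k ≤ ‖a ^ k‖ := by
  rcases Nat.eq_zero_or_pos k with rfl | hk
  · simp
  obtain ⟨m, rfl⟩ : ∃ m, k = m + 1 := ⟨k - 1, by omega⟩
  have h := spectrum.spectralRadius_le_pow_nnnorm_pow_one_div ℂ a m
  have h2 : (spectralRadius ℂ a).toReal ≤ ‖a ^ (m + 1)‖ ^ (1 / ((m + 1 : ℕ) : ℝ)) := by
    have h3 := ENNReal.toReal_mono
      (ENNReal.mul_ne_top (ENNReal.rpow_ne_top_of_nonneg (by positivity) (by simp))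
        (ENNReal.rpow_ne_top_of_nonneg (by positivity) (by simp))) h
    rw [ENNReal.toReal_mul, ← ENNReal.toReal_rpow, ← ENNReal.toReal_rpow] at h3
    simpa using h3
  calc _ ≤ (‖a ^ (m + 1)‖ ^ (1 / ((m + 1 : ℕ) : ℝ))) ^ (m + 1) :=
        pow_le_pow_left₀ ENNReal.toReal_nonneg h2 _
    _ = _ := by rw [one_div, Real.rpow_inv_natCast_pow (norm_nonneg _) (by omega)]

end Gelfand

/-! ## Weighted composition operators and words -/

section WeightedComp

variable {K ι 𝕜 : Type*} [TopologicalSpace K] [RCLike 𝕜]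

/-- The composition `τ_{p₁} ∘ ⋯ ∘ τ_{p_k}` along a word. -/
def wordMap (τ : ι → C(K, K)) : List ι → C(K, K)
  | [] => ContinuousMap.id K
  | p :: w => (τ p).comp (wordMap τ w)

/-- The weight accumulated along a word. -/
def wordWeight (τ : ι → C(K, K)) (c : ι → C(K, 𝕜)) : List ι → C(K, 𝕜)
  | [] => 1
  | p :: w => (c p).comp (wordMap τ w) * wordWeight τ c w

variable [CompactSpace K] [Fintype ι]

/-- The weighted composition operator `f ↦ ∑ p, c p * f ∘ τ p`. -/
def weightedComp (τ : ι → C(K, K)) (c : ι → C(K, 𝕜)) : C(K, 𝕜) →L[𝕜] C(K, 𝕜) where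
  toFun f := ∑ p, c p * f.comp (τ p)
  map_add' f f' := by
    rw [← Finset.sum_add_distrib]
    exact Finset.sum_congr rfl fun p _ => by rw [ContinuousMap.add_comp, mul_add]
  map_smul' x f := by
    rw [RingHom.id_apply, Finset.smul_sum]
    exact Finset.sum_congr rfl fun p _ => by rw [ContinuousMap.smul_comp, mul_smul_comm]
  cont := continuous_finsetSum _ fun p _ =>
    continuous_const.mul (ContinuousMap.continuous_precomp (τ p))

theorem weightedComp_apply (τ : ι → C(K, K)) (c : ι → C(K, 𝕜)) (f : C(K, 𝕜)) (t : K) :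
    weightedComp τ c f t = ∑ p, c p t * f (τ p t) := by
  change (∑ p, c p * f.comp (τ p)) t = _
  rw [ContinuousMap.sum_apply]
  rfl

theorem sum_ofFn_succ {M : Type*} [AddCommMonoid M] (k : ℕ) (F : List ι → M) :
    ∑ ω : Fin (k + 1) → ι, F (List.ofFn ω) = ∑ ω : Fin k → ι, ∑ p, F (p :: List.ofFn ω) := by
  rw [Finset.sum_comm, ← Finset.sum_product', Finset.univ_product_univ,
    ← (Fin.consEquiv fun _ => ι).sum_comp]
  refine Finset.sum_congr rfl fun x _ => ?_
  simp [Fin.consEquiv, List.ofFn_succ]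

theorem weightedComp_pow_apply (τ : ι → C(K, K)) (c : ι → C(K, 𝕜)) (k : ℕ) (f : C(K, 𝕜)) (t : K) :
    (weightedComp τ c ^ k) f t =
      ∑ ω : Fin k → ι, wordWeight τ c (List.ofFn ω) t * f (wordMap τ (List.ofFn ω) t) := by
  induction k generalizing f with
  | zero => simp [wordWeight, wordMap]
  | succ k ih =>
    -- The extra operator acts first on `f`, so its letter becomes the outermost map and is put at
    -- the head of the word.
    rw [pow_succ, mul_apply_eq_comp, ih,
      sum_ofFn_succ k fun w => wordWeight τ c w t * f (wordMap τ w t)]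
    refine Finset.sum_congr rfl fun ω _ => ?_
    rw [weightedComp_apply, Finset.mul_sum]
    refine Finset.sum_congr rfl fun p _ => ?_
    simp only [wordWeight, wordMap, ContinuousMap.mul_apply, ContinuousMap.comp_apply]
    ring

theorem norm_weightedComp_pow_le (τ : ι → C(K, K)) (c : ι → C(K, 𝕜)) (k : ℕ) {C : ℝ} (hC : 0 ≤ C)
    (h : ∀ t, ∑ ω : Fin k → ι, ‖wordWeight τ c (List.ofFn ω) t‖ ≤ C) :
    ‖weightedComp τ c ^ k‖ ≤ C := by
  refine ContinuousLinearMap.opNorm_le_bound _ hC fun f => ?_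
  rw [ContinuousMap.norm_le _ (by positivity)]
  intro t
  rw [weightedComp_pow_apply]
  calc _ ≤ ∑ ω : Fin k → ι, ‖wordWeight τ c (List.ofFn ω) t‖ * ‖f‖ := by
        refine (norm_sum_le _ _).trans (Finset.sum_le_sum fun ω _ => ?_)
        rw [norm_mul]
        gcongr
        exact f.norm_coe_le_norm _
    _ ≤ C * ‖f‖ := by
        rw [← Finset.sum_mul]
        gcongr
        exact h t

end WeightedComp

/-! ## Regularity of fixed points of weighted composition operators -/

section Regularity

variable {a b : ℝ}

/-- `u` is the derivative of `f` on `[a, b]`. -/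
def IsDerivOn (hab : a ≤ b) (f u : C(Set.Icc a b, ℝ)) : Prop :=
  ∀ t : Set.Icc a b, HasDerivWithinAt (Set.IccExtend hab f) (u t) (Set.Icc a b) t

theorem IsDerivOn.sub_eq_integral {hab : a ≤ b} {f u : C(Set.Icc a b, ℝ)}
    (h : IsDerivOn hab f u) (t : Set.Icc a b) :
    f t - f ⟨a, Set.left_mem_Icc.2 hab⟩ = ∫ x in a..t, Set.IccExtend hab u x := by
  have hu : Continuous (Set.IccExtend hab u) := u.continuous.Icc_extend'
  have hf : Continuous (Set.IccExtend hab f) := f.continuous.Icc_extend'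
  rw [intervalIntegral.integral_eq_sub_of_hasDerivAt_of_le t.2.1 hf.continuousOn
    (fun x hx => ?_) (hu.intervalIntegrable _ _)]
  · simp
  · have hx' : x ∈ Set.Icc a b := ⟨hx.1.le, hx.2.le.trans t.2.2⟩
    rw [Set.IccExtend_of_mem hab u hx']
    exact (h ⟨x, hx'⟩).hasDerivAt (Icc_mem_nhds hx.1 (hx.2.trans_le t.2.2))

theorem isDerivOn_of_sub_eq_integral {hab : a ≤ b} {f u : C(Set.Icc a b, ℝ)}
    (h : ∀ t : Set.Icc a b,
      f t - f ⟨a, Set.left_mem_Icc.2 hab⟩ = ∫ x in a..t, Set.IccExtend hab u x) :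
    IsDerivOn hab f u := by
  intro t
  have hu : Continuous (Set.IccExtend hab u) := u.continuous.Icc_extend'
  have h1 : HasDerivAt (fun y => f ⟨a, Set.left_mem_Icc.2 hab⟩ +
      ∫ x in a..y, Set.IccExtend hab u x) (u t) t := by
    have h2 := intervalIntegral.integral_hasDerivAt_right (hu.intervalIntegrable a t)
      (hu.stronglyMeasurableAtFilter _ _) hu.continuousAt
    rw [Set.IccExtend_of_mem hab u t.2] at h2
    exact h2.const_add _
  refine h1.hasDerivWithinAt.congr (fun y hy => ?_) ?_
  · rw [← h ⟨y, hy⟩, Set.IccExtend_of_mem hab f hy]; ring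
  · rw [← h t, Set.IccExtend_of_mem hab f t.2]; ring

theorem exists_isDerivOn_near (hab : a ≤ b) (f : C(Set.Icc a b, ℝ)) {ε : ℝ} (hε : 0 < ε) :
    ∃ ψ ψ' : C(Set.Icc a b, ℝ), IsDerivOn hab ψ ψ' ∧ ‖ψ - f‖ < ε := by
  obtain ⟨p, hp⟩ := exists_polynomial_near_continuousMap a b f ε hε
  refine ⟨p.toContinuousMapOn _, p.derivative.toContinuousMapOn _, fun t => ?_, hp⟩
  refine (p.hasDerivAt (t : ℝ)).hasDerivWithinAt.congr (fun y hy => ?_) ?_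
  · rw [Set.IccExtend_of_mem hab _ hy]; rfl
  · rw [Set.IccExtend_of_mem hab _ t.2]; rfl

theorem abs_integral_IccExtend_le (hab : a ≤ b) (u : C(Set.Icc a b, ℝ)) (t : Set.Icc a b) :
    |∫ x in a..t, Set.IccExtend hab u x| ≤ (b - a) * ‖u‖ := by
  have h := intervalIntegral.norm_integral_le_of_norm_le_const (a := a) (b := t) (C := ‖u‖)
    (f := Set.IccExtend hab u) (fun x _ => u.norm_coe_le_norm _)
  rw [Real.norm_eq_abs] at h
  refine h.trans ?_
  rw [abs_of_nonneg (sub_nonneg.2 t.2.1), mul_comm]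
  gcongr
  exact t.2.2

/-- If `‖T ^ k‖ → 0` exponentially then `w = T w + y` is solvable. -/
theorem exists_eq_add_of_norm_pow_le {X : Type*} [NormedAddCommGroup X] [NormedSpace ℝ X]
    [CompleteSpace X] (T : X →L[ℝ] X) {C κ : ℝ} (hκ : 0 ≤ κ) (hκ1 : κ < 1)
    (h : ∀ k : ℕ, ‖T ^ k‖ ≤ C * κ ^ k) (y : X) : ∃ w, w = T w + y := by
  obtain ⟨k, hk⟩ : ∃ k : ℕ, ‖T ^ k‖ < 1 := by
    have h1 : Tendsto (fun k : ℕ => C * κ ^ k) atTop (𝓝 0) := by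
      simpa using (tendsto_pow_atTop_nhds_zero_of_lt_one hκ hκ1).const_mul C
    obtain ⟨k, hk⟩ := (h1.eventually (gt_mem_nhds one_pos)).exists
    exact ⟨k, (h k).trans_lt hk⟩
  -- `T` itself need not be a contraction; the Neumann series is used for `T ^ k`, and the geometric
  -- sum factors `1 - T ^ k` through `1 - T`.
  have hu : IsUnit (1 - T ^ k) := isUnit_one_sub_of_norm_lt_one hk
  obtain ⟨v, hv⟩ := hu
  refine ⟨(∑ i ∈ Finset.range k, T ^ i) ((↑v⁻¹ : X →L[ℝ] X) y), ?_⟩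
  have h1 : (1 - T) * (∑ i ∈ Finset.range k, T ^ i) = ↑v := by
    rw [hv]; exact mul_neg_geom_sum T k
  have h2 : (1 - T) ((∑ i ∈ Finset.range k, T ^ i) ((↑v⁻¹ : X →L[ℝ] X) y)) = y := by
    rw [← mul_apply_eq_comp, h1, ← mul_apply_eq_comp, v.mul_inv]; rfl
  rw [sub_apply, one_apply_eq_self, sub_eq_iff_eq_add'] at h2
  exact h2

/-- Differentiating `f = A f + q` formally gives `w = A₁ w + B f + q'`, solvable since `A₁` has
contracting powers. To see that `w` really is the derivative, iterate both equations from a smooth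
approximation `ψ` of `f` and its derivative `ψ'`, then pass to the limit in the integrated form. -/
theorem exists_isDerivOn_of_eq_add (hab : a ≤ b)
    (A A₁ B : C(Set.Icc a b, ℝ) →L[ℝ] C(Set.Icc a b, ℝ))
    (q q' f : C(Set.Icc a b, ℝ))
    (hD : ∀ φ u, IsDerivOn hab φ u → IsDerivOn hab (A φ + q) (A₁ u + B φ + q'))
    {C κ : ℝ} (hκ : 0 ≤ κ) (hκ1 : κ < 1) (hA : ∀ k : ℕ, ‖A ^ k‖ ≤ C)
    (hA₁ : ∀ k : ℕ, ‖A₁ ^ k‖ ≤ C * κ ^ k) (hf : f = A f + q) :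
    ∃ w, IsDerivOn hab f w ∧ w = A₁ w + B f + q' := by
  have hC : 0 ≤ C := (norm_nonneg (A ^ 0)).trans (hA 0)
  obtain ⟨w, hw⟩ := exists_eq_add_of_norm_pow_le A₁ hκ hκ1 hA₁ (B f + q')
  rw [← add_assoc] at hw
  refine ⟨w, isDerivOn_of_sub_eq_integral fun t => ?_, hw⟩
  set D := C * (‖B‖ * C) / (1 - κ)
  have h1κ : 0 < 1 - κ := by linarith
  have hD0 : 0 ≤ D := by positivity
  -- The order of limits matters: `‖ψ' - w‖` is not controlled as `ε → 0`, but for fixed `ε` the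
  -- factor `κ ^ k` kills it. Thus `k → ∞` comes before `ε → 0`.
  have key : ∀ ε > 0, |f t - f ⟨a, Set.left_mem_Icc.2 hab⟩ - ∫ x in a..t, Set.IccExtend hab w x| ≤
      (2 * C + (b - a) * D) * ε := by
    intro ε hε
    obtain ⟨ψ, ψ', hψ, hnear⟩ := exists_isDerivOn_near hab f hε
    let P : ℕ → C(Set.Icc a b, ℝ) × C(Set.Icc a b, ℝ) := fun k =>
      Nat.rec (ψ, ψ') (fun _ x => (A x.1 + q, A₁ x.2 + B x.1 + q')) k
    have hP0 : P 0 = (ψ, ψ') := rfl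
    have hP1 : ∀ k, P (k + 1) = (A (P k).1 + q, A₁ (P k).2 + B (P k).1 + q') := fun _ => rfl
    have hderiv : ∀ k, IsDerivOn hab (P k).1 (P k).2 := by
      intro k
      induction k with
      | zero => exact hψ
      | succ k ih => rw [hP1]; exact hD _ _ ih
    have he : ∀ k, (P k).1 - f = (A ^ k) (ψ - f) := by
      intro k
      induction k with
      | zero => simp [hP0]
      | succ k ih =>
        rw [hP1, pow_succ', mul_apply_eq_comp, ← ih, map_sub]
        nth_rewrite 1 [hf]
        exact add_sub_add_right_eq_sub _ _ _
    have hen : ∀ k, ‖(P k).1 - f‖ ≤ C * ε := fun k => by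
      rw [he]
      exact ((A ^ k).le_opNorm _).trans (mul_le_mul (hA k) hnear.le (norm_nonneg _) hC)
    have hd : ∀ k, (P k).2 - w = (A₁ ^ k) (ψ' - w) +
        ∑ j ∈ Finset.range k, (A₁ ^ j) (B ((P (k - 1 - j)).1 - f)) := by
      intro k
      induction k with
      | zero => simp [hP0]
      | succ k ih =>
        have h1 : (P (k + 1)).2 - w = A₁ ((P k).2 - w) + B ((P k).1 - f) := by
          rw [hP1, map_sub, map_sub]
          nth_rewrite 1 [hw]
          exact (add_sub_add_right_eq_sub _ _ _).trans (add_sub_add_comm _ _ _ _)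
        rw [h1, ih, Finset.sum_range_succ', map_add, map_sum, pow_succ', mul_apply_eq_comp,
          add_assoc]
        congr 2
        refine Finset.sum_congr rfl fun j _ => ?_
        rw [pow_succ', mul_apply_eq_comp]
        congr 6
        omega
    have hdn : ∀ k, ‖(P k).2 - w‖ ≤ C * κ ^ k * ‖ψ' - w‖ + D * ε := by
      intro k
      rw [hd]
      refine (norm_add_le _ _).trans (add_le_add ?_ ?_)
      · exact ((A₁ ^ k).le_opNorm _).trans (by gcongr; exact hA₁ k)
      · calc _ ≤ ∑ j ∈ Finset.range k, C * (‖B‖ * C) * ε * κ ^ j := by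
              refine (norm_sum_le _ _).trans (Finset.sum_le_sum fun j _ => ?_)
              calc _ ≤ ‖A₁ ^ j‖ * (‖B‖ * ‖(P (k - 1 - j)).1 - f‖) :=
                    ((A₁ ^ j).le_opNorm _).trans (by gcongr; exact B.le_opNorm _)
                _ ≤ (C * κ ^ j) * (‖B‖ * (C * ε)) := by
                    gcongr
                    · exact hA₁ j
                    · exact hen _
                _ = _ := by ring
          _ = C * (‖B‖ * C) * ε * ∑ j ∈ Finset.range k, κ ^ j := by rw [Finset.mul_sum]
          _ ≤ C * (‖B‖ * C) * ε * (1 - κ)⁻¹ := by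
              gcongr
              rw [← tsum_geometric_of_lt_one hκ hκ1]
              exact (summable_geometric_of_lt_one hκ hκ1).sum_le_tsum _ fun _ _ => by positivity
          _ = D * ε := by simp only [D]; ring
    have hb : ∀ k, |f t - f ⟨a, Set.left_mem_Icc.2 hab⟩ - ∫ x in a..t, Set.IccExtend hab w x| ≤
        (2 * C + (b - a) * D) * ε + (b - a) * (C * ‖ψ' - w‖) * κ ^ k := by
      intro k
      have h1 := (hderiv k).sub_eq_integral t
      have h2 : ∫ x in a..t, Set.IccExtend hab ((P k).2 - w) x =
          (∫ x in a..t, Set.IccExtend hab (P k).2 x) - ∫ x in a..t, Set.IccExtend hab w x :=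
        intervalIntegral.integral_sub
          ((P k).2.continuous.Icc_extend'.intervalIntegrable _ _)
          (w.continuous.Icc_extend'.intervalIntegrable _ _)
      have h3 := abs_integral_IccExtend_le hab ((P k).2 - w) t
      have h4 := ((P k).1 - f).norm_coe_le_norm t
      have h5 := ((P k).1 - f).norm_coe_le_norm ⟨a, Set.left_mem_Icc.2 hab⟩
      rw [Real.norm_eq_abs, ContinuousMap.sub_apply] at h4 h5
      have h6 : (b - a) * ‖(P k).2 - w‖ ≤ (b - a) * (C * κ ^ k * ‖ψ' - w‖ + D * ε) :=
        mul_le_mul_of_nonneg_left (hdn k) (sub_nonneg.2 hab)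
      rw [h2, ← h1] at h3
      have h7 := hen k
      rw [abs_le] at *
      constructor <;> nlinarith
    have hlim : Tendsto (fun k : ℕ => (2 * C + (b - a) * D) * ε +
        (b - a) * (C * ‖ψ' - w‖) * κ ^ k) atTop (𝓝 ((2 * C + (b - a) * D) * ε + 0)) := by
      refine tendsto_const_nhds.add ?_
      simpa using (tendsto_pow_atTop_nhds_zero_of_lt_one hκ hκ1).const_mul
        ((b - a) * (C * ‖ψ' - w‖))
    simpa using ge_of_tendsto' hlim hb
  have hlim : Tendsto (fun ε : ℝ => (2 * C + (b - a) * D) * ε) (𝓝[>] 0) (𝓝 0) := by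
    have h1 : Tendsto (fun ε : ℝ => (2 * C + (b - a) * D) * ε) (𝓝 0)
        (𝓝 ((2 * C + (b - a) * D) * 0)) := (continuous_const.mul continuous_id).tendsto 0
    rw [mul_zero] at h1
    exact h1.mono_left nhdsWithin_le_nhds
  have h0 := ge_of_tendsto hlim (eventually_mem_nhdsWithin.mono fun ε hε => key ε hε)
  exact sub_eq_zero.1 (abs_nonpos_iff.1 h0)

end Regularity

/-- Converts the contraction hypothesis on `θ_ω` into a bound on its derivative. -/
theorem abs_le_of_hasDerivWithinAt_of_lip {a b : ℝ} (hab : a < b) {f : ℝ → ℝ} {f' t L : ℝ}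
    (ht : t ∈ Set.Icc a b) (hf : HasDerivWithinAt f f' (Set.Icc a b) t)
    (hL : ∀ x ∈ Set.Icc a b, |f x - f t| ≤ L * |x - t|) : |f'| ≤ L := by
  have hacc := uniqueDiffWithinAt_iff_accPt.1 (uniqueDiffOn_Icc hab t ht)
  have hne : (𝓝[Set.Icc a b \ {t}] t).NeBot := by
    rwa [accPt_principal_iff_nhdsWithin] at hacc
  have h1 := (hasDerivWithinAt_iff_tendsto_slope.1 hf).abs
  refine le_of_tendsto h1 (eventually_mem_nhdsWithin.mono fun x hx => ?_)
  have hxt : 0 < |x - t| := abs_pos.2 (sub_ne_zero.2 hx.2)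
  rw [slope_def_field, abs_div, div_le_iff₀ hxt]
  exact hL x hx.1

section

variable {a b : ℝ}

theorem IccExtend_eqOn (hab : a ≤ b) {g : ℝ → ℝ} (f : C(Set.Icc a b, ℝ))
    (h : ∀ t : Set.Icc a b, f t = g t) : Set.EqOn (Set.IccExtend hab f) g (Set.Icc a b) :=
  fun y hy => by rw [Set.IccExtend_of_mem hab f hy, h]

/-- The derivative of a `C^{m+1}` function on `[a, b]` as a continuous function. -/
theorem exists_continuousMap_deriv (hab : a < b) {m : ℕ} {g : ℝ → ℝ}
    (hg : ContDiffOn ℝ ((m + 1 : ℕ) : WithTop ℕ∞) g (Set.Icc a b)) :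
    ∃ u : C(Set.Icc a b, ℝ),
      (∀ t : Set.Icc a b, HasDerivWithinAt g (u t) (Set.Icc a b) t) ∧
        ContDiffOn ℝ (m : WithTop ℕ∞) (Set.IccExtend hab.le u) (Set.Icc a b) := by
  rw [Nat.cast_add, Nat.cast_one, contDiffOn_succ_iff_derivWithin (uniqueDiffOn_Icc hab)] at hg
  obtain ⟨h1, -, h2⟩ := hg
  refine ⟨⟨_, h2.continuousOn.domRestrict⟩, fun t => (h1 t t.2).hasDerivWithinAt, ?_⟩
  exact h2.congr (IccExtend_eqOn hab.le _ fun t => rfl)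

theorem IsDerivOn.contDiffOn_succ (hab : a < b) {m : ℕ} {f u : C(Set.Icc a b, ℝ)}
    (h : IsDerivOn hab.le f u)
    (hu : ContDiffOn ℝ (m : WithTop ℕ∞) (Set.IccExtend hab.le u) (Set.Icc a b)) :
    ContDiffOn ℝ ((m + 1 : ℕ) : WithTop ℕ∞) (Set.IccExtend hab.le f) (Set.Icc a b) := by
  rw [Nat.cast_add, Nat.cast_one, contDiffOn_succ_iff_derivWithin (uniqueDiffOn_Icc hab)]
  refine ⟨fun t ht => (h ⟨t, ht⟩).differentiableWithinAt, fun h => by simp at h, ?_⟩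
  refine hu.congr fun t ht => ?_
  rw [(h ⟨t, ht⟩).derivWithin (uniqueDiffOn_Icc hab t ht), Set.IccExtend_of_mem hab.le u ht]

end

theorem wordWeight_mul {K ι 𝕜 : Type*} [TopologicalSpace K] [RCLike 𝕜] (τ : ι → C(K, K))
    (c d : ι → C(K, 𝕜)) (w : List ι) :
    wordWeight τ (fun p => c p * d p) w = wordWeight τ c w * wordWeight τ d w := by
  induction w with
  | nil => simp [wordWeight]
  | cons p w ih =>
    simp only [wordWeight, ih]
    ext t
    simp only [ContinuousMap.mul_apply, ContinuousMap.comp_apply]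
    ring

/-! ### Smoothness of fixed points for the iterated function system. -/

namespace WeightedIFS

variable {a b : ℝ} {n : ℕ} (Φ : WeightedIFS a b n)

theorem coe_wordMap_thetaMap (w : List (Fin n)) (t : Set.Icc a b) :
    (wordMap Φ.thetaMap w t : ℝ) = Φ.thetaWord w t := by
  induction w with
  | nil => rfl
  | cons p w ih =>
    rw [thetaWord, ← ih]
    rfl

theorem hasDerivWithinAt_thetaWord {θ' : Fin n → C(Set.Icc a b, ℝ)}
    (hθ' : ∀ p, ∀ t : Set.Icc a b, HasDerivWithinAt (Φ.θ p) (θ' p t) (Set.Icc a b) t)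
    (w : List (Fin n)) (t : Set.Icc a b) :
    HasDerivWithinAt (Φ.thetaWord w) (wordWeight Φ.thetaMap θ' w t) (Set.Icc a b) t := by
  induction w with
  | nil => exact hasDerivWithinAt_id _ _
  | cons p w ih =>
    have hmaps : Set.MapsTo (Φ.thetaWord w) (Set.Icc a b) (Set.Icc a b) := fun y hy => by
      rw [← Φ.coe_wordMap_thetaMap w ⟨y, hy⟩]
      exact Subtype.mem _
    have h1 := hθ' p (wordMap Φ.thetaMap w t)
    rw [coe_wordMap_thetaMap] at h1
    exact h1.comp (t : ℝ) ih hmaps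

/-- Fixed points of weighted composition operators with `C^m` data and bounded iterates are of
class `C^m`. -/
theorem contDiffOn_of_eq_weightedComp_add (hab : a < b) (hcontr : Φ.EventuallyContracting) (m : ℕ)
    (hθ : ∀ p, ContDiffOn ℝ (m : WithTop ℕ∞) (Φ.θ p) (Set.Icc a b))
    (c : Fin n → C(Set.Icc a b, ℝ)) (q f : C(Set.Icc a b, ℝ))
    (hc : ∀ p, ContDiffOn ℝ (m : WithTop ℕ∞) (Set.IccExtend hab.le (c p)) (Set.Icc a b))
    (hq : ContDiffOn ℝ (m : WithTop ℕ∞) (Set.IccExtend hab.le q) (Set.Icc a b))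
    (hb : ∃ C, ∀ k : ℕ, ∀ t,
      ∑ ω : Fin k → Fin n, ‖wordWeight Φ.thetaMap c (List.ofFn ω) t‖ ≤ C)
    (hf : f = weightedComp Φ.thetaMap c f + q) :
    ContDiffOn ℝ (m : WithTop ℕ∞) (Set.IccExtend hab.le f) (Set.Icc a b) := by
  induction m generalizing c q f with
  | zero =>
    simp only [Nat.cast_zero, contDiffOn_zero]
    exact f.continuous.Icc_extend'.continuousOn
  | succ m ih =>
    have hmm : (m : WithTop ℕ∞) ≤ ((m + 1 : ℕ) : WithTop ℕ∞) := by exact_mod_cast Nat.le_succ m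
    have hfm : ContDiffOn ℝ (m : WithTop ℕ∞) (Set.IccExtend hab.le f) (Set.Icc a b) :=
      ih (fun p => (hθ p).of_le hmm) c q f (fun p => (hc p).of_le hmm) (hq.of_le hmm) hb hf
    choose θ' hθ'd hθ'c using fun p => exists_continuousMap_deriv hab (hθ p)
    choose c' hc'd hc'c using fun p => exists_continuousMap_deriv hab (hc p)
    obtain ⟨q', hq'd, hq'c⟩ := exists_continuousMap_deriv hab hq
    obtain ⟨C, hC⟩ := hb
    obtain ⟨C₀, κ, hC₀, hκ, hκ1, hlip⟩ := hcontr
    have hC0 : 0 ≤ C := (Finset.sum_nonneg fun _ _ => norm_nonneg _).trans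
      (hC 0 ⟨a, Set.left_mem_Icc.2 hab.le⟩)
    have hθw : ∀ (k : ℕ) (ω : Fin k → Fin n) (t : Set.Icc a b),
        ‖wordWeight Φ.thetaMap θ' (List.ofFn ω) t‖ ≤ C₀ * κ ^ k := by
      intro k ω t
      rcases Nat.eq_zero_or_pos k with rfl | hk
      · simpa [wordWeight] using hC₀
      · exact abs_le_of_hasDerivWithinAt_of_lip hab t.2
          (Φ.hasDerivWithinAt_thetaWord hθ'd (List.ofFn ω) t)
          fun x hx => hlip k hk ω x hx t t.2
    -- Along a word the weights `c p * θ' p` multiply to the weight of `c` times the derivative of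
    -- `θ_ω`, by the chain rule; the second factor supplies the decay `κ ^ k`.
    have hb₁ : ∀ (k : ℕ) (t : Set.Icc a b), ∑ ω : Fin k → Fin n,
        ‖wordWeight Φ.thetaMap (fun p => c p * θ' p) (List.ofFn ω) t‖ ≤ C * C₀ * κ ^ k := by
      intro k t
      calc _ ≤ ∑ ω : Fin k → Fin n,
            ‖wordWeight Φ.thetaMap c (List.ofFn ω) t‖ * (C₀ * κ ^ k) := by
            refine Finset.sum_le_sum fun ω _ => ?_
            rw [wordWeight_mul, ContinuousMap.mul_apply, norm_mul]
            gcongr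
            exact hθw k ω t
        _ ≤ C * (C₀ * κ ^ k) := by
            rw [← Finset.sum_mul]
            gcongr
            exact hC k t
        _ = _ := by ring
    obtain ⟨w, hw, hweq⟩ := exists_isDerivOn_of_eq_add hab.le (weightedComp Φ.thetaMap c)
      (weightedComp Φ.thetaMap fun p => c p * θ' p) (weightedComp Φ.thetaMap c') q q' f
      (C := C * C₀) (κ := κ) (fun φ u hφ t => by
        have h1 : ∀ p, HasDerivWithinAt
            (fun y => Set.IccExtend hab.le (c p) y * Set.IccExtend hab.le φ (Φ.θ p y))
            (c' p t * φ (Φ.thetaMap p t) + c p t * (u (Φ.thetaMap p t) * θ' p t))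
            (Set.Icc a b) t := fun p => by
          have h2 := (hφ (Φ.thetaMap p t)).comp (t : ℝ) (hθ'd p t) (Φ.mapsTo p)
          have h3 := (hc'd p t).mul h2
          refine h3.congr_deriv ?_
          simp only [Function.comp_apply, Set.IccExtend_of_mem hab.le (c p) t.2,
            Set.IccExtend_of_mem hab.le φ (Φ.mapsTo p t.2)]
          rfl
        have h4 := (HasDerivWithinAt.fun_sum fun p (_ : p ∈ Finset.univ) => h1 p).add (hq'd t)
        have h5 : Set.EqOn (Set.IccExtend hab.le (weightedComp Φ.thetaMap c φ + q))
            (fun y => ∑ p, Set.IccExtend hab.le (c p) y * Set.IccExtend hab.le φ (Φ.θ p y) +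
              Set.IccExtend hab.le q y) (Set.Icc a b) := by
          refine IccExtend_eqOn hab.le _ fun t => ?_
          simp only [ContinuousMap.add_apply, weightedComp_apply, Set.IccExtend_val]
          congr 1
          refine Finset.sum_congr rfl fun p _ => ?_
          rw [Set.IccExtend_of_mem hab.le φ (Φ.mapsTo p t.2)]
          rfl
        refine (h4.congr h5 (h5 t.2)).congr_deriv ?_
        simp only [ContinuousMap.add_apply, weightedComp_apply, ContinuousMap.mul_apply]
        rw [← Finset.sum_add_distrib]
        congr 1
        exact Finset.sum_congr rfl fun p _ => by ring)
      hκ.le hκ1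
      (fun k => norm_weightedComp_pow_le _ _ k (by positivity) fun t =>
        (hC k t).trans (le_mul_of_one_le_right hC0 hC₀))
      (fun k => norm_weightedComp_pow_le _ _ k (by positivity) (hb₁ k)) hf
    refine hw.contDiffOn_succ hab ?_
    have hmaps := fun p => Φ.mapsTo p
    -- The derivative `w` is again a fixed point of the same type. Its inhomogeneity is of class
    -- `C^m` because `f` already is, by `hfm`.
    refine ih (fun p => (hθ p).of_le hmm) (fun p => c p * θ' p)
      (weightedComp Φ.thetaMap c' f + q') w
      (fun p => ?_) ?_ ⟨C * C₀, fun k t => (hb₁ k t).trans ?_⟩ (by rw [← add_assoc]; exact hweq)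
    · exact (((hc p).of_le hmm).mul (hθ'c p)).congr (IccExtend_eqOn hab.le _ fun t => by
        simp [Set.IccExtend_val])
    · have h1 : ContDiffOn ℝ (m : WithTop ℕ∞) (fun y => ∑ p, Set.IccExtend hab.le (c' p) y *
          Set.IccExtend hab.le f (Φ.θ p y) + Set.IccExtend hab.le q' y) (Set.Icc a b) := by
        refine (ContDiffOn.sum fun p _ => (hc'c p).mul ?_).add hq'c
        exact hfm.comp ((hθ p).of_le hmm) (hmaps p)
      refine h1.congr (IccExtend_eqOn hab.le _ fun t => ?_)
      simp only [ContinuousMap.add_apply, weightedComp_apply, Set.IccExtend_val]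
      congr 1
      refine Finset.sum_congr rfl fun p _ => ?_
      rw [Set.IccExtend_of_mem hab.le f (Φ.mapsTo p t.2)]
      rfl
    · exact mul_le_of_le_one_right (by positivity) (pow_le_one₀ hκ.le hκ1.le)

end WeightedIFS

theorem wordWeight_smul {K ι 𝕜 : Type*} [TopologicalSpace K] [RCLike 𝕜] (τ : ι → C(K, K))
    (x : 𝕜) (c : ι → C(K, 𝕜)) (w : List ι) :
    wordWeight τ (fun p => x • c p) w = x ^ w.length • wordWeight τ c w := by
  induction w with
  | nil => simp [wordWeight]
  | cons p w ih =>
    simp only [wordWeight, ih, List.length_cons]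
    ext t
    simp only [ContinuousMap.mul_apply, ContinuousMap.comp_apply, ContinuousMap.smul_apply,
      smul_eq_mul]
    ring

/-! ### Bounded distortion, growth of the partition sums, and the positive eigenfunction. -/

namespace WeightedIFS

variable {a b : ℝ} {n : ℕ} (Φ : WeightedIFS a b n)

theorem thetaWord_mapsTo (w : List (Fin n)) :
    Set.MapsTo (Φ.thetaWord w) (Set.Icc a b) (Set.Icc a b) := fun y hy => by
  rw [← Φ.coe_wordMap_thetaMap w ⟨y, hy⟩]
  exact Subtype.mem _

theorem gWord_pos (w : List (Fin n)) {t : ℝ} (ht : t ∈ Set.Icc a b) : 0 < Φ.gWord w t := by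
  induction w with
  | nil => exact one_pos
  | cons p w ih => exact mul_pos (Φ.g_pos p (Φ.thetaWord_mapsTo w ht)) ih

theorem wordWeight_weight (𝕜 : Type*) [RCLike 𝕜] (s : ℝ) (w : List (Fin n)) (t : Set.Icc a b) :
    wordWeight Φ.thetaMap (Φ.weight 𝕜 s) w t = ((Φ.gWord w t ^ s : ℝ) : 𝕜) := by
  induction w with
  | nil => simp [wordWeight, gWord]
  | cons p w ih =>
    have h1 : Φ.weight 𝕜 s p (wordMap Φ.thetaMap w t) =
        ((Φ.g p (Φ.thetaWord w t) ^ s : ℝ) : 𝕜) := by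
      rw [← coe_wordMap_thetaMap]; rfl
    rw [wordWeight, ContinuousMap.mul_apply, ContinuousMap.comp_apply, ih, h1, gWord,
      Real.mul_rpow (Φ.nonneg p _ (Φ.thetaWord_mapsTo w t.2)) (Φ.gWord_pos w t.2).le]
    push_cast
    rfl

theorem transferOp_eq_weightedComp (𝕜 : Type*) [RCLike 𝕜] (s : ℝ) :
    Φ.transferOp 𝕜 s = weightedComp Φ.thetaMap (Φ.weight 𝕜 s) := rfl

variable {Φ} in
-- Bounded distortion: each letter is evaluated at points already contracted by the rest `w` of the
-- word, so it contributes `M₀ C₀ κ ^ w.length` to the exponent. The geometric series bounds the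
-- total independently of the word.
theorem EventuallyContracting.exists_gWord_le (h : Φ.EventuallyContracting) :
    ∃ B : ℝ, 0 ≤ B ∧ ∀ w : List (Fin n), ∀ t₁ ∈ Set.Icc a b, ∀ t₂ ∈ Set.Icc a b,
      Φ.gWord w t₁ ≤ Φ.gWord w t₂ * Real.exp (B * |t₁ - t₂|) := by
  obtain ⟨C₀, κ, hC₀, hκ, hκ1, hlip⟩ := h
  obtain ⟨M₀, hM₀, hlog⟩ := Φ.log_lipschitz
  have hlip' : ∀ w : List (Fin n), ∀ t₁ ∈ Set.Icc a b, ∀ t₂ ∈ Set.Icc a b,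
      |Φ.thetaWord w t₁ - Φ.thetaWord w t₂| ≤ C₀ * κ ^ w.length * |t₁ - t₂| := by
    intro w t₁ h₁ t₂ h₂
    rcases Nat.eq_zero_or_pos w.length with hk | hk
    · rw [List.length_eq_zero_iff] at hk
      subst hk
      simpa [thetaWord] using le_mul_of_one_le_left (abs_nonneg (t₁ - t₂)) hC₀
    · have := hlip w.length hk w.get t₁ h₁ t₂ h₂
      rwa [List.ofFn_get] at this
  have h1κ : 0 < 1 - κ := by linarith
  have key : ∀ w : List (Fin n), ∀ t₁ ∈ Set.Icc a b, ∀ t₂ ∈ Set.Icc a b,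
      Φ.gWord w t₁ ≤ Φ.gWord w t₂ *
        Real.exp (M₀ * (C₀ * ∑ j ∈ Finset.range w.length, κ ^ j) * |t₁ - t₂|) := by
    intro w t₁ h₁ t₂ h₂
    induction w with
    | nil => simp [gWord]
    | cons p w ih =>
      have h3 := hlog p _ (Φ.thetaWord_mapsTo w h₁) _ (Φ.thetaWord_mapsTo w h₂)
      have h4 : Φ.g p (Φ.thetaWord w t₁) ≤ Φ.g p (Φ.thetaWord w t₂) *
          Real.exp (M₀ * (C₀ * κ ^ w.length * |t₁ - t₂|)) := by
        refine h3.trans (mul_le_mul_of_nonneg_left ?_ (Φ.nonneg p _ (Φ.thetaWord_mapsTo w h₂)))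
        gcongr
        exact hlip' w t₁ h₁ t₂ h₂
      calc Φ.gWord (p :: w) t₁ ≤ _ := mul_le_mul h4 ih (Φ.gWord_pos w h₁).le
            (mul_nonneg (Φ.nonneg p _ (Φ.thetaWord_mapsTo w h₂)) (Real.exp_pos _).le)
        _ = Φ.gWord (p :: w) t₂ * (Real.exp (M₀ * (C₀ * κ ^ w.length * |t₁ - t₂|)) *
            Real.exp (M₀ * (C₀ * ∑ j ∈ Finset.range w.length, κ ^ j) * |t₁ - t₂|)) := by
            simp only [gWord]; ring
        _ = _ := by
            rw [← Real.exp_add, List.length_cons, Finset.sum_range_succ]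
            congr 2
            ring
  refine ⟨M₀ * (C₀ * (1 - κ)⁻¹), by positivity, fun w t₁ h₁ t₂ h₂ => ?_⟩
  refine (key w t₁ h₁ t₂ h₂).trans (mul_le_mul_of_nonneg_left ?_ (Φ.gWord_pos w h₂).le)
  gcongr
  rw [← tsum_geometric_of_lt_one hκ.le hκ1]
  exact (summable_geometric_of_lt_one hκ.le hκ1).sum_le_tsum _ fun _ _ => by positivity

/-- The `k`-th iterate of `L_s` applied to the constant function `1`. -/
def partitionSum (s : ℝ) (k : ℕ) (t : ℝ) : ℝ :=
  ∑ ω : Fin k → Fin n, Φ.gWord (List.ofFn ω) t ^ s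

theorem partitionSum_pos (hn : 0 < n) (s : ℝ) (k : ℕ) {t : ℝ} (ht : t ∈ Set.Icc a b) :
    0 < Φ.partitionSum s k t := by
  have : Nonempty (Fin n) := ⟨⟨0, hn⟩⟩
  exact Finset.sum_pos (fun ω _ => Real.rpow_pos_of_pos (Φ.gWord_pos _ ht) _)
    Finset.univ_nonempty

theorem transferOp_pow_one_apply (𝕜 : Type*) [RCLike 𝕜] (s : ℝ) (k : ℕ) (t : Set.Icc a b) :
    (Φ.transferOp 𝕜 s ^ k) 1 t = ((Φ.partitionSum s k t : ℝ) : 𝕜) := by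
  rw [transferOp_eq_weightedComp, weightedComp_pow_apply, partitionSum, RCLike.ofReal_sum]
  refine Finset.sum_congr rfl fun ω _ => ?_
  rw [wordWeight_weight]
  simp

theorem sum_norm_wordWeight (𝕜 : Type*) [RCLike 𝕜] (s : ℝ) (k : ℕ) (t : Set.Icc a b) :
    ∑ ω : Fin k → Fin n, ‖wordWeight Φ.thetaMap (Φ.weight 𝕜 s) (List.ofFn ω) t‖ =
      Φ.partitionSum s k t := by
  refine Finset.sum_congr rfl fun ω _ => ?_
  rw [wordWeight_weight, RCLike.norm_ofReal,
    abs_of_nonneg (Real.rpow_nonneg (Φ.gWord_pos _ t.2).le _)]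

theorem partitionSum_add (s : ℝ) (k l : ℕ) (t : Set.Icc a b) :
    Φ.partitionSum s (k + l) t = ∑ ω : Fin k → Fin n,
      Φ.gWord (List.ofFn ω) t ^ s * Φ.partitionSum s l (Φ.thetaWord (List.ofFn ω) t) := by
  have h := Φ.transferOp_pow_one_apply ℝ s (k + l) t
  rw [pow_add, mul_apply_eq_comp, transferOp_eq_weightedComp,
    weightedComp_pow_apply] at h
  refine h.symm.trans (Finset.sum_congr rfl fun ω _ => ?_)
  rw [wordWeight_weight, ← transferOp_eq_weightedComp, transferOp_pow_one_apply,
    coe_wordMap_thetaMap]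
  rfl

theorem partitionSum_succ (s : ℝ) (k : ℕ) {t : ℝ} (ht : t ∈ Set.Icc a b) :
    Φ.partitionSum s (k + 1) t = ∑ p, Φ.g p t ^ s * Φ.partitionSum s k (Φ.θ p t) := by
  have h := Φ.transferOp_pow_one_apply ℝ s (k + 1) ⟨t, ht⟩
  rw [pow_succ', mul_apply_eq_comp, transferOp_apply] at h
  refine h.symm.trans (Finset.sum_congr rfl fun p _ => ?_)
  rw [transferOp_pow_one_apply]
  rfl

variable {Φ} in
theorem EventuallyContracting.exists_partitionSum_le (h : Φ.EventuallyContracting) {s : ℝ}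
    (hs : 0 ≤ s) :
    ∃ B : ℝ, 0 ≤ B ∧ ∀ k : ℕ, ∀ t₁ ∈ Set.Icc a b, ∀ t₂ ∈ Set.Icc a b,
      Φ.partitionSum s k t₁ ≤ Real.exp (B * |t₁ - t₂|) * Φ.partitionSum s k t₂ := by
  obtain ⟨B, hB, hg⟩ := h.exists_gWord_le
  refine ⟨s * B, by positivity, fun k t₁ h₁ t₂ h₂ => ?_⟩
  rw [partitionSum, partitionSum, Finset.mul_sum]
  refine Finset.sum_le_sum fun ω _ => ?_
  calc _ ≤ (Φ.gWord (List.ofFn ω) t₂ * Real.exp (B * |t₁ - t₂|)) ^ s :=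
        Real.rpow_le_rpow (Φ.gWord_pos _ h₁).le (hg _ t₁ h₁ t₂ h₂) hs
    _ = _ := by
        rw [Real.mul_rpow (Φ.gWord_pos _ h₂).le (Real.exp_pos _).le, ← Real.exp_mul, mul_comm]
        congr 2
        ring

theorem lam_pow_le_norm_transferOp_pow [Nonempty (Set.Icc a b)] (s : ℝ) (k : ℕ) :
    Φ.lam s ^ k ≤ ‖Φ.transferOp ℂ s ^ k‖ := by
  unfold lam
  exact spectralRadius_pow_le_norm_pow (Φ.transferOp ℂ s) k

theorem le_lam_of_frequently (s : ℝ) {x : ℝ} (hx : 0 ≤ x)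
    (h : ∃ᶠ k : ℕ in atTop, 1 * x ^ k ≤ ‖Φ.transferOp ℂ s ^ k‖) : x ≤ Φ.lam s := by
  unfold lam
  exact le_spectralRadius_of_frequently (a := Φ.transferOp ℂ s) one_pos hx h

theorem partitionSum_le_norm_transferOp_pow (hn : 0 < n) (s : ℝ) (k : ℕ) (t : Set.Icc a b) :
    Φ.partitionSum s k t ≤ ‖Φ.transferOp ℂ s ^ k‖ := by
  have : Nonempty (Set.Icc a b) := ⟨t⟩
  have h1 : ‖(Φ.transferOp ℂ s ^ k) 1 t‖ ≤ ‖(Φ.transferOp ℂ s ^ k) 1‖ :=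
    ContinuousMap.norm_coe_le_norm _ _
  have h2 : ‖(Φ.transferOp ℂ s ^ k) 1‖ ≤ ‖Φ.transferOp ℂ s ^ k‖ * ‖(1 : C(Set.Icc a b, ℂ))‖ :=
    ContinuousLinearMap.le_opNorm _ _
  rw [transferOp_pow_one_apply, RCLike.norm_ofReal,
    abs_of_pos (Φ.partitionSum_pos hn s k t.2)] at h1
  rw [norm_one, mul_one] at h2
  exact h1.trans h2

variable {Φ} in
/-- The iterates of `L_s` on the constant function `1` are comparable to `λ_s ^ k`. -/
theorem EventuallyContracting.exists_partitionSum_bounds (h : Φ.EventuallyContracting)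
    (hab : a < b) (hn : 0 < n) {s : ℝ} (hs : 0 ≤ s) :
    0 < Φ.lam s ∧ ∃ D : ℝ, 0 < D ∧ ∀ k : ℕ, ∀ t ∈ Set.Icc a b,
      Φ.lam s ^ k ≤ D * Φ.partitionSum s k t ∧ Φ.partitionSum s k t ≤ D * Φ.lam s ^ k := by
  obtain ⟨B, hB, hZ⟩ := h.exists_partitionSum_le hs
  set D := Real.exp (B * (b - a)) with hD
  have hD0 : 0 < D := Real.exp_pos _
  have hZD : ∀ k : ℕ, ∀ t₁ ∈ Set.Icc a b, ∀ t₂ ∈ Set.Icc a b,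
      Φ.partitionSum s k t₁ ≤ D * Φ.partitionSum s k t₂ := by
    intro k t₁ h₁ t₂ h₂
    refine (hZ k t₁ h₁ t₂ h₂).trans
      (mul_le_mul_of_nonneg_right ?_ (Φ.partitionSum_pos hn s k h₂).le)
    rw [hD]
    gcongr
    exact abs_sub_le_of_le_of_le h₁.1 h₁.2 h₂.1 h₂.2
  have ha : a ∈ Set.Icc a b := Set.left_mem_Icc.2 hab.le
  have : Nonempty (Set.Icc a b) := ⟨⟨a, ha⟩⟩
  have hpos := fun k => Φ.partitionSum_pos hn s k ha
  have hupper : ∀ k, Φ.lam s ^ k ≤ D * Φ.partitionSum s k a := fun k =>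
    (Φ.lam_pow_le_norm_transferOp_pow s k).trans
      (norm_weightedComp_pow_le _ _ k (mul_pos hD0 (hpos k)).le fun t => by
        rw [sum_norm_wordWeight]
        exact hZD k t t.2 a ha)
  have hsuper : ∀ k l, Φ.partitionSum s k a * (Φ.partitionSum s l a / D) ≤
      Φ.partitionSum s (k + l) a := by
    -- The inner partition sum at any point is at least its value at `a` divided by `D`; this gives
    -- supermultiplicativity up to `D`.
    intro k l
    have h1 := Φ.partitionSum_add s k l ⟨a, ha⟩
    simp only at h1
    rw [h1]
    conv_lhs => rw [partitionSum, Finset.sum_mul]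
    refine Finset.sum_le_sum fun ω _ => mul_le_mul_of_nonneg_left ?_
      (Real.rpow_nonneg (Φ.gWord_pos _ ha).le _)
    rw [div_le_iff₀' hD0]
    exact hZD l a ha _ (Φ.thetaWord_mapsTo _ ha)
  have hnorm : ∀ k, Φ.partitionSum s k a ≤ ‖Φ.transferOp ℂ s ^ k‖ := fun k =>
    Φ.partitionSum_le_norm_transferOp_pow hn s k ⟨a, ha⟩
  have hlower : ∀ k, Φ.partitionSum s k a / D ≤ Φ.lam s ^ k := by
    intro k
    rcases Nat.eq_zero_or_pos k with rfl | hk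
    · have hD1 : 1 ≤ D := Real.one_le_exp (mul_nonneg hB (sub_nonneg.2 hab.le))
      simpa [partitionSum, gWord] using inv_le_one_of_one_le₀ hD1
    have hk0 : k ≠ 0 := by omega
    have hz : 0 ≤ Φ.partitionSum s k a / D := (div_pos (hpos k) hD0).le
    -- Supermultiplicativity gives `‖L_s ^ (k * j)‖ ≥ x ^ (k * j)` for all `j`, and a lower bound
    -- along the multiples of `k` suffices in Gelfand's formula.
    set x := (Φ.partitionSum s k a / D) ^ ((k : ℝ)⁻¹) with hx
    have hxk : x ^ k = Φ.partitionSum s k a / D := Real.rpow_inv_natCast_pow hz hk0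
    have hx0 : 0 ≤ x := Real.rpow_nonneg hz _
    have hle : x ≤ Φ.lam s := by
      refine Φ.le_lam_of_frequently s hx0 (frequently_atTop.2 fun j =>
        ⟨k * j, Nat.le_mul_of_pos_left j hk, ?_⟩)
      rw [one_mul, pow_mul, hxk]
      refine le_trans ?_ (hnorm _)
      clear_value x
      induction j with
      | zero => simp [partitionSum, gWord]
      | succ j ih =>
        rw [pow_succ, Nat.mul_succ]
        exact (mul_le_mul_of_nonneg_right ih hz).trans (hsuper _ _)
    rw [← hxk]
    exact pow_le_pow_left₀ hx0 hle k
  refine ⟨?_, D * D, by positivity, fun k t ht => ⟨?_, ?_⟩⟩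
  · simpa using (div_pos (hpos 1) hD0).trans_le (hlower 1)
  · refine (hupper k).trans ?_
    rw [mul_assoc]
    exact mul_le_mul_of_nonneg_left (hZD k a ha t ht) hD0.le
  · refine (hZD k t ht a ha).trans ?_
    rw [mul_assoc]
    refine mul_le_mul_of_nonneg_left ?_ hD0.le
    have := hlower k
    rwa [div_le_iff₀' hD0] at this

variable {Φ} in
/-- The transfer operator has a strictly positive continuous eigenfunction with eigenvalue its
spectral radius. -/
theorem EventuallyContracting.exists_continuous_eigenfunction (h : Φ.EventuallyContracting)
    (hab : a < b) (hn : 0 < n) {s : ℝ} (hs : 0 ≤ s) :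
    ∃ v : C(Set.Icc a b, ℝ), (∀ t, 0 < v t) ∧ Φ.transferOp ℝ s v = Φ.lam s • v := by
  obtain ⟨hlam, D, hD, hbd⟩ := h.exists_partitionSum_bounds hab hn hs
  obtain ⟨B, hB, hZ⟩ := h.exists_partitionSum_le hs
  set lam := Φ.lam s
  let u : ℕ → ℝ → ℝ := fun k t => Φ.partitionSum s k t / lam ^ k
  have hu : ∀ k, ∀ t ∈ Set.Icc a b, u k t ∈ Set.Icc D⁻¹ D := fun k t ht =>
    ⟨by rw [le_div_iff₀ (pow_pos hlam k), inv_mul_le_iff₀ hD]; exact (hbd k t ht).1,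
      by rw [div_le_iff₀ (pow_pos hlam k)]; exact (hbd k t ht).2⟩
  have hulip : ∀ k, ∀ t₁ ∈ Set.Icc a b, ∀ t₂ ∈ Set.Icc a b,
      u k t₁ ≤ Real.exp (B * |t₁ - t₂|) * u k t₂ := fun k t₁ h₁ t₂ h₂ => by
    simp only [u]
    rw [← mul_div_assoc]
    gcongr
    exact hZ k t₁ h₁ t₂ h₂
  have hurec : ∀ k, ∀ t ∈ Set.Icc a b, ∑ p, Φ.g p t ^ s * u k (Φ.θ p t) = lam * u (k + 1) t := by
    intro k t ht
    simp only [u]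
    rw [Φ.partitionSum_succ s k ht, pow_succ', Finset.sum_div, Finset.mul_sum]
    refine Finset.sum_congr rfl fun p _ => ?_
    field_simp
  -- Cesàro means of `λ_s ^ (-k) L_s^k 1`. They lie in `[D⁻¹, D]`, so they converge pointwise along
  -- an ultrafilter; the uniform log-Lipschitz bound survives the limit and gives continuity.
  let φ : ℕ → ℝ → ℝ := fun N t => (∑ k ∈ Finset.range (N + 1), u k t) / ((N : ℝ) + 1)
  have hφ : ∀ N, ∀ t ∈ Set.Icc a b, φ N t ∈ Set.Icc D⁻¹ D := by
    intro N t ht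
    have hN : (0 : ℝ) < (N : ℝ) + 1 := by positivity
    constructor
    · rw [le_div_iff₀ hN]
      have := Finset.card_nsmul_le_sum (Finset.range (N + 1)) (fun k => u k t) D⁻¹
        fun k _ => (hu k t ht).1
      simp only [Finset.card_range, nsmul_eq_mul] at this
      push_cast at this
      linarith
    · rw [div_le_iff₀ hN]
      have := Finset.sum_le_card_nsmul (Finset.range (N + 1)) (fun k => u k t) D
        fun k _ => (hu k t ht).2
      simp only [Finset.card_range, nsmul_eq_mul] at this
      push_cast at this
      linarith
  have hex : ∀ t : Set.Icc a b, ∃ x ∈ Set.Icc D⁻¹ D,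
      Tendsto (fun N => φ N t) (hyperfilter ℕ) (𝓝 x) := by
    intro t
    obtain ⟨x, hx, hle⟩ := isCompact_Icc.ultrafilter_le_nhds
      ((hyperfilter ℕ).map fun N => φ N t)
      (by
        rw [le_principal_iff, Ultrafilter.mem_coe, Ultrafilter.mem_map]
        exact univ_mem' fun N => hφ N t t.2)
    exact ⟨x, hx, hle⟩
  choose v hvmem hv using hex
  have hvlip : ∀ t₁ t₂ : Set.Icc a b, v t₁ ≤ Real.exp (B * |(t₁ : ℝ) - t₂|) * v t₂ := by
    intro t₁ t₂
    refine le_of_tendsto_of_tendsto' (hv t₁) ((hv t₂).const_mul _) fun N => ?_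
    simp only [φ]
    rw [← mul_div_assoc, Finset.mul_sum]
    gcongr with k
    exact hulip k t₁ t₁.2 t₂ t₂.2
  have hvdiff : ∀ t₁ t₂ : Set.Icc a b, v t₁ - v t₂ ≤ D * (Real.exp (B * |(t₁ : ℝ) - t₂|) - 1) := by
    intro t₁ t₂
    have h1 := hvlip t₁ t₂
    have h2 : 1 ≤ Real.exp (B * |(t₁ : ℝ) - t₂|) := Real.one_le_exp (by positivity)
    have h3 := (hvmem t₂).2
    nlinarith
  have hvcont : Continuous v := by
    refine continuous_iff_continuousAt.2 fun t₀ => tendsto_iff_dist_tendsto_zero.2 ?_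
    have h1 : Continuous fun t : Set.Icc a b =>
        D * (Real.exp (B * |(t : ℝ) - t₀|) - 1) := by fun_prop
    have h2 := h1.tendsto t₀
    simp only [sub_self, abs_zero, mul_zero, Real.exp_zero] at h2
    refine squeeze_zero (fun _ => dist_nonneg) (fun t => ?_) h2
    rw [Real.dist_eq, abs_sub_le_iff]
    refine ⟨hvdiff t t₀, ?_⟩
    rw [abs_sub_comm]
    exact hvdiff t₀ t
  refine ⟨⟨v, hvcont⟩, fun t => (inv_pos.2 hD).trans_le (hvmem t).1, ?_⟩
  ext t
  rw [transferOp_apply, ContinuousMap.smul_apply, smul_eq_mul]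
  have hl : Tendsto (fun N => ∑ p, Φ.g p t ^ s * φ N (Φ.θ p t)) (hyperfilter ℕ)
      (𝓝 (∑ p, Φ.g p t ^ s * v (Φ.thetaMap p t))) :=
    tendsto_finsetSum _ fun p _ => (hv (Φ.thetaMap p t)).const_mul _
  -- Applying `L_s` shifts the average by one index, so the sums differ only in their end terms and
  -- the error is `O(1 / N)`.
  have heq : ∀ N, ∑ p, Φ.g p t ^ s * φ N (Φ.θ p t) =
      lam * (φ N t + (u (N + 1) t - u 0 t) / ((N : ℝ) + 1)) := by
    intro N
    have h1 : ∑ p, Φ.g p t ^ s * φ N (Φ.θ p t) =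
        (∑ k ∈ Finset.range (N + 1), ∑ p, Φ.g p t ^ s * u k (Φ.θ p t)) / ((N : ℝ) + 1) := by
      rw [Finset.sum_comm, Finset.sum_div]
      refine Finset.sum_congr rfl fun p _ => ?_
      simp only [φ]
      rw [← mul_div_assoc, Finset.mul_sum]
    rw [h1, Finset.sum_congr rfl fun k _ => hurec k t t.2, ← Finset.mul_sum]
    have h2 : ∑ k ∈ Finset.range (N + 1), u (k + 1) t =
        ∑ k ∈ Finset.range (N + 1), u k t + (u (N + 1) t - u 0 t) := by
      have h3 := Finset.sum_range_succ (fun k => u k t) (N + 1)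
      rw [Finset.sum_range_succ'] at h3
      linarith
    rw [h2]
    simp only [φ]
    ring
  have herr : Tendsto (fun N : ℕ => (u (N + 1) t - u 0 t) / ((N : ℝ) + 1)) (hyperfilter ℕ)
      (𝓝 0) := by
    refine Tendsto.mono_left ?_ Nat.hyperfilter_le_atTop
    have h1 : Tendsto (fun N : ℕ => D * (1 / ((N : ℝ) + 1))) atTop (𝓝 0) := by
      simpa using tendsto_one_div_add_atTop_nhds_zero_nat.const_mul D
    refine squeeze_zero_norm (fun N => ?_) h1
    have h2 := hu (N + 1) t t.2
    have h3 := hu 0 t t.2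
    have h4 : 0 < D⁻¹ := inv_pos.2 hD
    rw [Real.norm_eq_abs, abs_div, abs_of_pos (by positivity : (0 : ℝ) < (N : ℝ) + 1), div_eq_mul_one_div]
    gcongr
    rw [abs_le]
    constructor <;> linarith [h2.1, h2.2, h3.1, h3.2]
  have hr : Tendsto (fun N => ∑ p, Φ.g p t ^ s * φ N (Φ.θ p t)) (hyperfilter ℕ)
      (𝓝 (lam * (v t + 0))) := by
    simp_rw [heq]
    exact ((hv t).add herr).const_mul _
  rw [add_zero] at hr
  exact tendsto_nhds_unique hl hr

variable {Φ} in
theorem EventuallyContracting.exists_isPosEigenfunction (h : Φ.EventuallyContracting)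
    (hab : a < b) (hn : 0 < n) {s : ℝ} (hs : 0 ≤ s) (m : ℕ)
    (hθ : ∀ p, ContDiffOn ℝ (m : WithTop ℕ∞) (Φ.θ p) (Set.Icc a b))
    (hg : ∀ p, ContDiffOn ℝ (m : WithTop ℕ∞) (Φ.g p) (Set.Icc a b)) :
    ∃ v, Φ.IsPosEigenfunction s m v := by
  obtain ⟨v, hpos, hv⟩ := h.exists_continuous_eigenfunction hab hn hs
  obtain ⟨hlam, D, hD, hbd⟩ := h.exists_partitionSum_bounds hab hn hs
  refine ⟨Set.IccExtend hab.le v, ?_, fun x hx => ?_, fun x hx => ?_⟩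
  -- With the weights divided by `λ_s`, the eigenfunction is a fixed point, and the partition sum
  -- bound says that the iterates stay bounded by `D`.
  · refine Φ.contDiffOn_of_eq_weightedComp_add hab h m hθ
      (fun p => (Φ.lam s)⁻¹ • Φ.weight ℝ s p) 0 v (fun p => ?_) ?_ ⟨D, fun k t => ?_⟩ ?_
    · have h1 : ContDiffOn ℝ (m : WithTop ℕ∞) (fun x => (Φ.lam s)⁻¹ * Φ.g p x ^ s) (Set.Icc a b) :=
        contDiffOn_const.mul ((hg p).rpow_const_of_ne fun x hx => (Φ.g_pos p hx).ne')
      exact h1.congr (IccExtend_eqOn hab.le _ fun t => rfl)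
    · exact contDiffOn_const (c := (0 : ℝ)) |>.congr (IccExtend_eqOn hab.le _ fun t => rfl)
    · simp_rw [wordWeight_smul, ContinuousMap.smul_apply, norm_smul, List.length_ofFn]
      rw [← Finset.mul_sum, sum_norm_wordWeight, norm_pow, norm_inv, Real.norm_eq_abs,
        abs_of_pos hlam, inv_pow, inv_mul_le_iff₀ (pow_pos hlam k), mul_comm]
      exact (hbd k t t.2).2
    · ext t
      have h1 := congrArg (fun f : C(Set.Icc a b, ℝ) => f t) hv
      simp only [transferOp_apply, ContinuousMap.smul_apply, smul_eq_mul] at h1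
      simp only [weightedComp_apply, ContinuousMap.smul_apply, smul_eq_mul, add_zero, mul_assoc]
      rw [← Finset.mul_sum, eq_inv_mul_iff_mul_eq₀ hlam.ne', ← h1]
      rfl
  · rw [Set.IccExtend_of_mem hab.le v hx]
    exact hpos _
  · have h1 := congrArg (fun f : C(Set.Icc a b, ℝ) => f ⟨x, hx⟩) hv
    simp only [transferOp_apply, ContinuousMap.smul_apply, smul_eq_mul] at h1
    rw [Set.IccExtend_of_mem hab.le v hx, ← h1]
    refine Finset.sum_congr rfl fun p _ => ?_
    rw [Set.IccExtend_of_mem hab.le v (Φ.mapsTo p hx)]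
    rfl

theorem IsPosEigenfunction.sum_word {s : ℝ} {m : ℕ} {v : ℝ → ℝ} {Φ : WeightedIFS a b n}
    (hv : Φ.IsPosEigenfunction s m v) (k : ℕ) {t : ℝ} (ht : t ∈ Set.Icc a b) :
    ∑ ω : Fin k → Fin n, Φ.gWord (List.ofFn ω) t ^ s * v (Φ.thetaWord (List.ofFn ω) t) =
      Φ.lam s ^ k * v t := by
  induction k with
  | zero => simp [gWord, thetaWord]
  | succ k ih =>
    rw [sum_ofFn_succ k fun w => Φ.gWord w t ^ s * v (Φ.thetaWord w t), pow_succ', mul_assoc, ← ih,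
      Finset.mul_sum]
    refine Finset.sum_congr rfl fun ω _ => ?_
    have h1 := hv.2.2 _ (Φ.thetaWord_mapsTo (List.ofFn ω) ht)
    rw [mul_left_comm, ← h1, Finset.mul_sum]
    refine Finset.sum_congr rfl fun p _ => ?_
    rw [gWord, thetaWord, Real.mul_rpow (Φ.nonneg p _ (Φ.thetaWord_mapsTo _ ht))
      (Φ.gWord_pos _ ht).le]
    ring

end WeightedIFS

/-! ## The error of polynomial interpolation -/

section Interpolation

open Polynomial

/-- Rolle's theorem, iterated. The zeros of the derivative are interior to consecutive gaps, hence
again strictly ordered and one fewer in number. Only `z 0, …, z m` matter; later values are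
arbitrary. -/
theorem exists_iteratedDerivWithin_eq_zero {a b α β : ℝ} (hab : a < b)
    (hα : a ≤ α) (hβ : β ≤ b) (m : ℕ) (g : ℝ → ℝ)
    (hg : ContDiffOn ℝ (m : WithTop ℕ∞) g (Set.Icc a b)) (z : ℕ → ℝ)
    (hz : ∀ i < m, z i < z (i + 1)) (hmem : ∀ i ≤ m, z i ∈ Set.Icc α β) (h0 : ∀ i ≤ m, g (z i) = 0) :
    ∃ ξ ∈ Set.Icc α β, iteratedDerivWithin m g (Set.Icc a b) ξ = 0 := by
  induction m generalizing g z with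
  | zero => exact ⟨z 0, hmem 0 le_rfl, by simpa using h0 0 le_rfl⟩
  | succ m ih =>
    rw [Nat.cast_add, Nat.cast_one, contDiffOn_succ_iff_derivWithin (uniqueDiffOn_Icc hab)] at hg
    obtain ⟨hd, -, hc⟩ := hg
    have hex : ∀ i, ∃ y, i ≤ m → y ∈ Set.Ioo (z i) (z (i + 1)) ∧
        derivWithin g (Set.Icc a b) y = 0 := by
      intro i
      by_cases hi : i ≤ m
      · have hzi := hz i (by omega)
        have hl := (hmem i (by omega)).1
        have hr := (hmem (i + 1) (by omega)).2
        obtain ⟨y, hy, hy0⟩ := exists_hasDerivAt_eq_zero (f := g)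
          (f' := derivWithin g (Set.Icc a b)) hzi
          (hd.continuousOn.mono (Set.Icc_subset_Icc (hα.trans hl) (hr.trans hβ)))
          ((h0 i (by omega)).trans (h0 (i + 1) (by omega)).symm) (fun x hx => by
            have hxa : a < x := (hα.trans hl).trans_lt hx.1
            have hxb : x < b := hx.2.trans_le (hr.trans hβ)
            exact (hd x ⟨hxa.le, hxb.le⟩).hasDerivWithinAt.hasDerivAt (Icc_mem_nhds hxa hxb))
        exact ⟨y, fun _ => ⟨hy, hy0⟩⟩
      · exact ⟨0, fun h => absurd h hi⟩
    choose y hy using hex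
    rw [iteratedDerivWithin_succ']
    refine ih _ hc y (fun i hi => ?_) (fun i hi => ?_) fun i hi => (hy i hi).2
    · exact (hy i hi.le).1.2.trans (hy (i + 1) hi).1.1
    · exact ⟨(hmem i (by omega)).1.trans (hy i hi).1.1.le,
        (hy i hi).1.2.le.trans (hmem (i + 1) (by omega)).2⟩

theorem exists_iteratedDerivWithin_eq_zero_of_finset {a b α β : ℝ} (hab : a < b)
    (hα : a ≤ α) (hβ : β ≤ b) (m : ℕ) (g : ℝ → ℝ)
    (hg : ContDiffOn ℝ (m : WithTop ℕ∞) g (Set.Icc a b)) (Z : Finset ℝ) (hZ : Z.card = m + 1)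
    (hmem : ∀ x ∈ Z, x ∈ Set.Icc α β) (h0 : ∀ x ∈ Z, g x = 0) :
    ∃ ξ ∈ Set.Icc α β, iteratedDerivWithin m g (Set.Icc a b) ξ = 0 := by
  let e := Z.orderEmbOfFin hZ
  let z : ℕ → ℝ := fun i => e ⟨min i m, by omega⟩
  have hzZ : ∀ i, z i ∈ Z := fun i => Z.orderEmbOfFin_mem hZ _
  refine exists_iteratedDerivWithin_eq_zero hab hα hβ m g hg z (fun i hi => ?_)
    (fun i _ => hmem _ (hzZ i)) fun i _ => h0 _ (hzZ i)
  refine e.strictMono ?_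
  rw [Fin.mk_lt_mk]
  omega

theorem iteratedDerivWithin_polynomial {S : Set ℝ} (hS : UniqueDiffOn ℝ S) (k : ℕ) (p : ℝ[X])
    {x : ℝ} (hx : x ∈ S) :
    iteratedDerivWithin k (fun t => p.eval t) S x = (derivative^[k] p).eval x := by
  induction k generalizing p with
  | zero => simp
  | succ k ih =>
    rw [iteratedDerivWithin_succ', Function.iterate_succ_apply, ← ih]
    exact iteratedDerivWithin_congr (fun y hy => p.derivWithin (hS y hy)) hx

theorem iterate_derivative_of_monic {p : ℝ[X]} (hp : p.Monic) {d : ℕ} (hd : p.natDegree = d) :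
    derivative^[d] p = C (d.factorial : ℝ) := by
  have h1 : (p - X ^ d).degree < (d : WithBot ℕ) := by
    have h2 : p.degree = (d : WithBot ℕ) := by rw [degree_eq_natDegree hp.ne_zero, hd]
    refine (degree_sub_lt_left ?_ hp.ne_zero ?_).trans_eq h2
    · rw [h2, degree_X_pow]
    · rw [hp.leadingCoeff, (monic_X_pow d).leadingCoeff]
  rw [← sub_add_cancel p (X ^ d), iterate_map_add, iterate_derivative_eq_zero_of_degree_lt h1, zero_add,
    iterate_derivative_X_pow_eq_natCast_mul]
  simp [Nat.descFactorial_self]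

/-- The error formula for polynomial interpolation. -/
theorem exists_sub_interpolate_eq {a b α β : ℝ} (hab : a < b) (hα : a ≤ α) (hβ : β ≤ b) (r : ℕ)
    (v : ℝ → ℝ) (hv : ContDiffOn ℝ ((r + 1 : ℕ) : WithTop ℕ∞) v (Set.Icc a b))
    (c : Fin (r + 1) → ℝ) (hc : Function.Injective c) (hmem : ∀ k, c k ∈ Set.Icc α β)
    {x : ℝ} (hx : x ∈ Set.Icc α β) :
    ∃ ξ ∈ Set.Icc α β, v x - (Lagrange.interpolate Finset.univ c fun k => v (c k)).eval x =
      iteratedDerivWithin (r + 1) v (Set.Icc a b) ξ / (r + 1).factorial * ∏ k, (x - c k) := by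
  set p := Lagrange.interpolate Finset.univ c fun k => v (c k) with hp
  have hnode : ∀ k, p.eval (c k) = v (c k) := fun k =>
    Lagrange.eval_interpolate_at_node _ hc.injOn (Finset.mem_univ k)
  by_cases hxc : ∃ k, x = c k
  · obtain ⟨k, rfl⟩ := hxc
    refine ⟨c k, hx, ?_⟩
    rw [hnode, sub_self, Finset.prod_eq_zero (Finset.mem_univ k) (sub_self _), mul_zero]
  push Not at hxc
  have hω : ∏ k, (x - c k) ≠ 0 := Finset.prod_ne_zero_iff.2 fun k _ => sub_ne_zero.2 (hxc k)
  -- `K` is chosen so that `v - Q` vanishes at `x` as well as at the nodes: `r + 2` zeros in all.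
  set K := (v x - p.eval x) / ∏ k, (x - c k) with hK
  set Q := p + C K * Lagrange.nodal Finset.univ c with hQ
  have hQeval : ∀ y, Q.eval y = p.eval y + K * ∏ k, (y - c k) := fun y => by
    simp [hQ, Lagrange.eval_nodal]
  have hQd : derivative^[r + 1] Q = C (K * (r + 1).factorial) := by
    have h1 : p.degree < ((r + 1 : ℕ) : WithBot ℕ) := by
      have h2 := Lagrange.degree_interpolate_lt (s := Finset.univ) (fun k => v (c k)) hc.injOn
      rwa [Finset.card_univ, Fintype.card_fin] at h2
    rw [hQ, iterate_map_add, iterate_derivative_eq_zero_of_degree_lt h1, zero_add,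
      iterate_derivative_C_mul, iterate_derivative_of_monic (Lagrange.nodal_monic)
        (by rw [Lagrange.natDegree_nodal]; simp), C_mul]
  have hQc : ContDiff ℝ ((r + 1 : ℕ) : WithTop ℕ∞) fun t => Q.eval t := by
    simpa using Q.contDiff_aeval (𝕜 := ℝ) ((r + 1 : ℕ) : WithTop ℕ∞)
  have hS : UniqueDiffOn ℝ (Set.Icc a b) := uniqueDiffOn_Icc hab
  classical
  obtain ⟨ξ, hξ, h0⟩ := exists_iteratedDerivWithin_eq_zero_of_finset hab hα hβ (r + 1)
    (v - fun t => Q.eval t) (hv.sub hQc.contDiffOn) (insert x (Finset.univ.image c))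
    (by
      rw [Finset.card_insert_of_notMem (by simpa using fun k => (hxc k).symm),
        Finset.card_image_of_injective _ hc]
      simp)
    (by simpa using ⟨hx, hmem⟩)
    (by
      simp only [Finset.mem_insert, Finset.mem_image, Finset.mem_univ, true_and, Pi.sub_apply]
      rintro y (rfl | ⟨k, rfl⟩)
      · rw [hQeval, hK, div_mul_cancel₀ _ hω]; ring
      · rw [hQeval, hnode, Finset.prod_eq_zero (Finset.mem_univ k) (sub_self _)]; ring)
  have hξS : ξ ∈ Set.Icc a b := ⟨hα.trans hξ.1, hξ.2.trans hβ⟩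
  rw [iteratedDerivWithin_sub hξS hS (hv ξ hξS) hQc.contDiffWithinAt,
    iteratedDerivWithin_polynomial hS _ _ hξS, hQd, eval_C, sub_eq_zero] at h0
  refine ⟨ξ, hξ, ?_⟩
  have hfac : ((r + 1).factorial : ℝ) ≠ 0 := by exact_mod_cast (Nat.factorial_ne_zero _)
  rw [h0, mul_div_assoc, div_self hfac, mul_one, hK, div_mul_cancel₀ _ hω]

end Interpolation

/-! ## Extended Chebyshev points -/

section Chebyshev

theorem chebAngle_pos (r : ℕ) : 0 < Real.pi / (2 * r + 2) := by positivity

theorem cos_chebAngle_pos {r : ℕ} (hr : 1 ≤ r) : 0 < Real.cos (Real.pi / (2 * r + 2)) := by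
  refine Real.cos_pos_of_mem_Ioo ⟨by linarith [chebAngle_pos r, Real.pi_pos], ?_⟩
  have h1 : (1 : ℝ) ≤ r := by exact_mod_cast hr
  exact div_lt_div_of_pos_left Real.pi_pos (by norm_num) (by linarith)

theorem sin_chebAngle_pos (r : ℕ) : 0 < Real.sin (Real.pi / (2 * r + 2)) := by
  refine Real.sin_pos_of_pos_of_lt_pi (chebAngle_pos r) ?_
  exact div_lt_self Real.pi_pos (by linarith [(Nat.cast_nonneg r : (0 : ℝ) ≤ r)])

open Polynomial in
theorem prod_sub_cos_eq (r : ℕ) (x : ℝ) :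
    (Chebyshev.T ℝ (r + 1 : ℕ)).eval x =
      2 ^ r * ∏ k : Fin (r + 1), (x - Real.cos ((2 * (k : ℝ) + 1) / (2 * r + 2) * Real.pi)) := by
  have hroots := Chebyshev.roots_T_real (r + 1)
  have hnod := Chebyshev.roots_T_real_nodup (r + 1)
  have hinj := (Finset.range (r + 1)).nodup_map_iff_injOn.mp hnod
  have hcard : Multiset.card (Chebyshev.T ℝ (r + 1 : ℕ)).roots =
      (Chebyshev.T ℝ (r + 1 : ℕ)).natDegree := by
    rw [hroots, Finset.card_val, Finset.card_image_of_injOn hinj, Chebyshev.natDegree_T,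
      Finset.card_range, Int.natAbs_natCast]
  have h := C_leadingCoeff_mul_prod_multiset_X_sub_C hcard
  rw [← h, Chebyshev.leadingCoeff_T, hroots, eval_mul, eval_C]
  congr 1
  change eval x (∏ y ∈ Finset.image _ _, (X - C y)) = _
  rw [Finset.prod_image hinj, eval_prod, Finset.prod_range]
  refine Finset.prod_congr rfl fun k _ => ?_
  rw [eval_sub, eval_X, eval_C]
  congr 2
  push_cast
  ring

/-- The extended points are the zeros of `T_(r+1)` divided by `-γ`. The product is therefore, up to
sign, `T_(r+1)(-γ y)` divided by `2 ^ r γ ^ (r + 1)`, and `|γ y| ≤ 1`. -/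
theorem abs_prod_sub_chebPoint_le {r : ℕ} (hr : 1 ≤ r) {y : ℝ} (hy : |y| ≤ 1) :
    |∏ k, (y - chebPoint r k)| ≤
      (1 / Real.cos (Real.pi / (2 * r + 2))) ^ (r + 1) * (1 / 2 ^ r) := by
  set γ := Real.cos (Real.pi / (2 * r + 2)) with hγ
  have hγ0 : 0 < γ := cos_chebAngle_pos hr
  have h1 : ∏ k, (y - chebPoint r k) = (-1 / γ) ^ (r + 1) *
      ∏ k : Fin (r + 1), (-(y * γ) - Real.cos ((2 * (k : ℝ) + 1) / (2 * r + 2) * Real.pi)) := by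
    have h2 : (-1 / γ) ^ (r + 1) = ∏ _k : Fin (r + 1), (-1 / γ) := by
      rw [Finset.prod_const, Finset.card_univ, Fintype.card_fin]
    rw [h2, ← Finset.prod_mul_distrib]
    refine Finset.prod_congr rfl fun k _ => ?_
    rw [chebPoint, ← hγ]
    field_simp
    ring
  have h3 := prod_sub_cos_eq r (-(y * γ))
  have h4 := Polynomial.Chebyshev.abs_eval_T_real_le_one ((r + 1 : ℕ) : ℤ) (x := -(y * γ)) (by
    rw [abs_neg, abs_mul, abs_of_pos hγ0]
    exact mul_le_one₀ hy hγ0.le (Real.cos_le_one _))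
  rw [h3, abs_mul, abs_of_pos (by positivity : (0 : ℝ) < 2 ^ r)] at h4
  rw [h1, abs_mul, abs_pow, abs_div, abs_neg, abs_one, abs_of_pos hγ0]
  gcongr
  rwa [le_div_iff₀' (by positivity)]

/-- With `x = π / (2r+2)`, the difference is `2 sin((k+l+1)x) sin((l-k)x) / cos x`. Since `2 ≤ k+l+1
≤ 2r` and `2r x = π - 2x`, the first sine is at least `sin 2x = 2 sin x cos x`; the second is at
least `sin x`. -/
theorem chebPoint_sub_le {r : ℕ} (hr : 1 ≤ r) {k l : Fin (r + 1)} (hkl : k < l) :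
    4 * Real.sin (Real.pi / (2 * r + 2)) ^ 2 ≤ chebPoint r l - chebPoint r k := by
  set x := Real.pi / (2 * r + 2) with hx
  have hγ0 : 0 < Real.cos x := cos_chebAngle_pos hr
  have hs0 : 0 < Real.sin x := sin_chebAngle_pos r
  have hx0 : 0 < x := chebAngle_pos r
  have hxpi : (2 * (r : ℝ) + 2) * x = Real.pi := by rw [hx]; field_simp
  have hkl' : (k : ℝ) + 1 ≤ l := by exact_mod_cast hkl
  have hlr : (l : ℝ) ≤ r := by exact_mod_cast Nat.lt_succ_iff.1 l.2
  have hk0 : (0 : ℝ) ≤ k := Nat.cast_nonneg _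
  have hr1 : (1 : ℝ) ≤ r := by exact_mod_cast hr
  have hpi := Real.pi_pos
  have e1 : chebPoint r l - chebPoint r k =
      2 * Real.sin ((k + l + 1) * x) * Real.sin ((l - k) * x) / Real.cos x := by
    have h2 := Real.cos_sub_cos ((2 * (k : ℝ) + 1) * x) ((2 * (l : ℝ) + 1) * x)
    have h3 : ((2 * (k : ℝ) + 1) * x + (2 * (l : ℝ) + 1) * x) / 2 = (k + l + 1) * x := by ring
    have h4 : ((2 * (k : ℝ) + 1) * x - (2 * (l : ℝ) + 1) * x) / 2 = -((l - k) * x) := by ring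
    rw [h3, h4, Real.sin_neg] at h2
    have h5 : ∀ j : Fin (r + 1), (2 * (j : ℝ) + 1) / (2 * r + 2) * Real.pi = (2 * (j : ℝ) + 1) * x :=
      fun j => by rw [hx]; ring
    rw [chebPoint, chebPoint, h5, h5, ← hx, ← sub_div]
    congr 1
    linarith
  have hA : Real.sin (2 * x) ≤ Real.sin ((k + l + 1) * x) := by
    rcases le_total ((k + l + 1) * x) (Real.pi / 2) with h | h
    · exact Real.sin_le_sin_of_le_of_le_pi_div_two (by linarith) h (by nlinarith)
    · rw [← Real.sin_pi_sub ((k + l + 1) * x)]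
      refine Real.sin_le_sin_of_le_of_le_pi_div_two (by linarith) (by linarith) ?_
      nlinarith
  have hB : Real.sin x ≤ Real.sin ((l - k) * x) :=
    Real.sin_le_sin_of_le_of_le_pi_div_two (by linarith) (by nlinarith) (by nlinarith)
  rw [e1, le_div_iff₀ hγ0]
  rw [Real.sin_two_mul] at hA
  have h6 : 2 * Real.sin x * Real.cos x * Real.sin x ≤
      Real.sin ((k + l + 1) * x) * Real.sin ((l - k) * x) :=
    mul_le_mul hA hB hs0.le (le_trans (by positivity) hA)
  nlinarith

theorem chebPoint_zero {r : ℕ} (hr : 1 ≤ r) : chebPoint r 0 = -1 := by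
  have h : (2 * ((0 : Fin (r + 1)) : ℕ) + 1 : ℝ) / (2 * r + 2) * Real.pi =
      Real.pi / (2 * r + 2) := by
    simp; ring
  rw [chebPoint, h, neg_div, div_self (cos_chebAngle_pos hr).ne']

theorem chebPoint_last {r : ℕ} (hr : 1 ≤ r) : chebPoint r (Fin.last r) = 1 := by
  have h : (2 * ((Fin.last r : Fin (r + 1)) : ℕ) + 1 : ℝ) / (2 * r + 2) * Real.pi =
      Real.pi - Real.pi / (2 * r + 2) := by
    rw [Fin.val_last]; field_simp; ring
  rw [chebPoint, h, Real.cos_pi_sub, neg_neg, div_self (cos_chebAngle_pos hr).ne']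

theorem chebPoint_strictMono {r : ℕ} (hr : 1 ≤ r) : StrictMono (chebPoint r) := fun k l hkl => by
  have h1 := chebPoint_sub_le hr hkl
  have h2 := sin_chebAngle_pos r
  nlinarith [pow_pos h2 2]

theorem chebPoint_mem {r : ℕ} (hr : 1 ≤ r) (k : Fin (r + 1)) : chebPoint r k ∈ Set.Icc (-1) 1 := by
  rw [← chebPoint_zero hr, ← chebPoint_last hr]
  exact ⟨(chebPoint_strictMono hr).monotone (Fin.zero_le k),
    (chebPoint_strictMono hr).monotone (Fin.le_last k)⟩

theorem two_mul_sin_chebAngle_sq_le {r : ℕ} (hr : 1 ≤ r) :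
    2 * Real.sin (Real.pi / (2 * r + 2)) ^ 2 ≤ 1 := by
  have h0 : (0 : Fin (r + 1)) < Fin.last r := Fin.lt_def.2 (by rw [Fin.val_zero, Fin.val_last]; omega)
  have h := chebPoint_sub_le hr h0
  rw [chebPoint_zero hr, chebPoint_last hr] at h
  linarith

end Chebyshev

/-! ### Geometry of the mesh, interpolation error and separation of the nodes. -/

namespace IntervalMesh

variable {I : ℕ} (𝓜 : IntervalMesh I)

theorem width_pos (i : Fin I) : 0 < 𝓜.width i :=
  div_pos (sub_pos.2 (𝓜.left_lt_right i)) (by exact_mod_cast 𝓜.N_pos i)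

theorem left_add_N_mul_width (i : Fin I) : 𝓜.left i + 𝓜.N i * 𝓜.width i = 𝓜.right i := by
  have : (𝓜.N i : ℝ) ≠ 0 := by exact_mod_cast (𝓜.N_pos i).ne'
  rw [width, mul_div_cancel₀ _ this]
  ring

theorem width_le_h (i : Fin I) : 𝓜.width i ≤ 𝓜.h :=
  le_ciSup (Set.finite_range _).bddAbove i

theorem hmin_le_width (i : Fin I) : 𝓜.hmin ≤ 𝓜.width i :=
  ciInf_le (Set.finite_range _).bddBelow i

theorem h_pos [Nonempty (Fin I)] : 0 < 𝓜.h :=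
  (𝓜.width_pos (Classical.arbitrary _)).trans_le (𝓜.width_le_h _)

theorem hmin_pos [Nonempty (Fin I)] : 0 < 𝓜.hmin := by
  obtain ⟨i, hi⟩ := exists_eq_ciInf_of_finite (f := 𝓜.width)
  rw [hmin, ← hi]
  exact 𝓜.width_pos i

theorem left_add_mul_width_le (i : Fin I) (j : Fin (𝓜.N i)) :
    𝓜.left i + ((j : ℝ) + 1) * 𝓜.width i ≤ 𝓜.right i := by
  rw [← 𝓜.left_add_N_mul_width i]
  have h1 : (j : ℝ) + 1 ≤ 𝓜.N i := by exact_mod_cast j.2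
  have := 𝓜.width_pos i
  gcongr

theorem node_mem_cell {r : ℕ} (hr : 1 ≤ r) (i : Fin I) (j : Fin (𝓜.N i)) (k : Fin (r + 1)) :
    𝓜.node r i j k ∈ Set.Icc (𝓜.left i + (j : ℝ) * 𝓜.width i)
      (𝓜.left i + ((j : ℝ) + 1) * 𝓜.width i) := by
  have h1 := chebPoint_mem hr k
  have h2 := 𝓜.width_pos i
  rw [node]
  constructor <;> nlinarith [h1.1, h1.2]

theorem node_mem_Icc {r : ℕ} (hr : 1 ≤ r) (i : Fin I) (j : Fin (𝓜.N i)) (k : Fin (r + 1)) :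
    𝓜.node r i j k ∈ Set.Icc (𝓜.left i) (𝓜.right i) := by
  have h1 := 𝓜.node_mem_cell hr i j k
  have h2 := 𝓜.width_pos i
  have h3 : (0 : ℝ) ≤ (j : ℝ) * 𝓜.width i := by positivity
  exact ⟨by linarith [h1.1], h1.2.trans (𝓜.left_add_mul_width_le i j)⟩

theorem node_injective {r : ℕ} (hr : 1 ≤ r) (i : Fin I) (j : Fin (𝓜.N i)) :
    Function.Injective (𝓜.node r i j) := by
  intro k l hkl
  have h2 := (𝓜.width_pos i).ne'
  refine (chebPoint_strictMono hr).injective ?_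
  simp only [node] at hkl
  have h3 : 𝓜.width i * (chebPoint r k - chebPoint r l) = 0 := by linarith
  exact sub_eq_zero.1 ((mul_eq_zero.1 h3).resolve_left h2)

theorem mem_cell (i : Fin I) {x : ℝ} (hx : x ∈ Set.Icc (𝓜.left i) (𝓜.right i)) :
    x ∈ Set.Icc (𝓜.left i + (𝓜.cell i x : ℝ) * 𝓜.width i)
      (𝓜.left i + ((𝓜.cell i x : ℝ) + 1) * 𝓜.width i) := by
  have h2 := 𝓜.width_pos i
  have hN := 𝓜.N_pos i
  set y := (x - 𝓜.left i) / 𝓜.width i with hy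
  have hxy : x = 𝓜.left i + y * 𝓜.width i := by rw [hy, div_mul_cancel₀ _ h2.ne']; ring
  have hy0 : 0 ≤ y := div_nonneg (sub_nonneg.2 hx.1) h2.le
  have hyN : y ≤ 𝓜.N i := by
    rw [hy, div_le_iff₀ h2]
    linarith [hx.2, 𝓜.left_add_N_mul_width i]
  have hcell : ((𝓜.cell i x : Fin (𝓜.N i)) : ℕ) = min ⌊y⌋₊ (𝓜.N i - 1) := rfl
  have hlo : ((𝓜.cell i x : ℕ) : ℝ) ≤ y := by
    rw [hcell]
    exact (Nat.cast_le.2 (min_le_left _ _)).trans (Nat.floor_le hy0)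
  have hhi : y ≤ ((𝓜.cell i x : ℕ) : ℝ) + 1 := by
    rw [hcell]
    rcases le_total ⌊y⌋₊ (𝓜.N i - 1) with h | h
    · rw [min_eq_left h]
      exact (Nat.lt_floor_add_one y).le
    · rw [min_eq_right h]
      have : ((𝓜.N i - 1 : ℕ) : ℝ) + 1 = 𝓜.N i := by
        rw [Nat.cast_sub hN]; simp
      linarith
  constructor
  · linarith [mul_le_mul_of_nonneg_right hlo h2.le]
  · linarith [mul_le_mul_of_nonneg_right hhi h2.le]

theorem interp_eq {r : ℕ} (F : 𝓜.T r → ℝ) (i : Fin I) {x : ℝ}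
    (hx : x ∈ Set.Icc (𝓜.left i) (𝓜.right i)) :
    𝓜.interp r F x = (Lagrange.interpolate Finset.univ (𝓜.node r i (𝓜.cell i x)) fun k =>
      F ⟨𝓜.node r i (𝓜.cell i x) k, 𝓜.node_mem_T r i (𝓜.cell i x) k⟩).eval x := by
  classical
  rw [interp, Finset.sum_eq_single i, if_pos hx, Lagrange.interpolate_apply,
    Polynomial.eval_finsetSum]
  · refine Finset.sum_congr rfl fun k _ => ?_
    rw [Polynomial.eval_mul, Polynomial.eval_C, mul_comm]
  · intro i' _ hi'
    refine if_neg fun hx' => ?_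
    rcases lt_or_gt_of_ne hi' with h | h
    · have := 𝓜.ordered _ _ h
      linarith [hx.1, hx'.2]
    · have := 𝓜.ordered _ _ h
      linarith [hx.2, hx'.1]
  · simp

/-- The interpolation error of a function whose derivative of order `r + 1` is controlled by the
function itself. -/
theorem abs_interp_sub_le {a b : ℝ} (hab : a < b) {r : ℕ} (hr : 1 ≤ r) {s E χ : ℝ} (hs : 0 < s)
    (hχ : 0 < χ) {v : ℝ → ℝ} (hv : ContDiffOn ℝ ((r + 1 : ℕ) : WithTop ℕ∞) v (Set.Icc a b))
    (hpos : ∀ x ∈ Set.Icc a b, 0 < v x)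
    (hv₁ : ∀ x ∈ Set.Icc a b, |iteratedDerivWithin (r + 1) v (Set.Icc a b) x| / v x ≤ E)
    (hv₂ : ∀ x₁ ∈ Set.Icc a b, ∀ x₂ ∈ Set.Icc a b, v x₁ ≤ v x₂ * Real.exp (2 * s * |x₁ - x₂| / χ))
    (i : Fin I) (hi : Set.Icc (𝓜.left i) (𝓜.right i) ⊆ Set.Icc a b) {x : ℝ}
    (hx : x ∈ Set.Icc (𝓜.left i) (𝓜.right i)) :
    |𝓜.interp r (fun ξ => v ξ) x - v x| ≤ constG r s E χ 𝓜.h * 𝓜.h ^ (r + 1) * v x := by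
  have hw := 𝓜.width_pos i
  have hwh := 𝓜.width_le_h i
  have hcell := 𝓜.mem_cell i hx
  set j := 𝓜.cell i x with hj
  set w := 𝓜.width i with hwdef
  set α := 𝓜.left i + (j : ℝ) * w with hα
  have hα1 : 𝓜.left i + ((j : ℝ) + 1) * w = α + w := by rw [hα]; ring
  have hsub : Set.Icc α (α + w) ⊆ Set.Icc (𝓜.left i) (𝓜.right i) := by
    refine Set.Icc_subset_Icc ?_ ?_
    · have : (0 : ℝ) ≤ (j : ℝ) * w := by positivity
      linarith
    · rw [← hα1]; exact 𝓜.left_add_mul_width_le i j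
  rw [hα1] at hcell
  have hαS := hi (hsub (Set.left_mem_Icc.2 (by linarith : α ≤ α + w)))
  have hβS := hi (hsub (Set.right_mem_Icc.2 (by linarith : α ≤ α + w)))
  obtain ⟨ξ, hξ, herr⟩ := exists_sub_interpolate_eq hab hαS.1 hβS.2 r v hv (𝓜.node r i j)
    (𝓜.node_injective hr i j) (fun k => by rw [← hα1]; exact 𝓜.node_mem_cell hr i j k) hcell
  have hξS := hi (hsub hξ)
  have hxS := hi hx
  have hE : 0 ≤ E := (div_nonneg (abs_nonneg _) (hpos x hxS).le).trans (hv₁ x hxS)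
  have hder : |iteratedDerivWithin (r + 1) v (Set.Icc a b) ξ| ≤
      E * Real.exp (2 * s * 𝓜.h / χ) * v x := by
    have h1 := hv₁ ξ hξS
    rw [div_le_iff₀ (hpos ξ hξS)] at h1
    refine h1.trans ?_
    rw [mul_assoc, mul_comm (Real.exp _)]
    refine mul_le_mul_of_nonneg_left ((hv₂ ξ hξS x hxS).trans ?_) hE
    have h2 : |ξ - x| ≤ 𝓜.h :=
      (abs_sub_le_of_le_of_le hξ.1 hξ.2 hcell.1 hcell.2).trans (by linarith)
    have := (hpos x hxS).le
    gcongr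
  have hprod : |∏ k, (x - 𝓜.node r i j k)| ≤ (𝓜.h / 2) ^ (r + 1) *
      ((1 / Real.cos (Real.pi / (2 * r + 2))) ^ (r + 1) * (1 / 2 ^ r)) := by
    -- The affine coordinate on the cell, in which each factor `x - node` is `w / 2` times `y -
    -- chebPoint`.
    set y := 2 * (x - α) / w - 1 with hy
    have hyw : w / 2 * (y + 1) = x - α := by rw [hy]; field_simp; ring
    have hy1 : |y| ≤ 1 := by
      rw [abs_le]
      constructor
      · have : 0 ≤ 2 * (x - α) / w := div_nonneg (by linarith [hcell.1]) hw.le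
        linarith
      · have : 2 * (x - α) / w ≤ 2 := by rw [div_le_iff₀ hw]; linarith [hcell.2]
        linarith
    have h1 : ∏ k, (x - 𝓜.node r i j k) = (w / 2) ^ (r + 1) * ∏ k, (y - chebPoint r k) := by
      have h2 : (w / 2) ^ (r + 1) = ∏ _k : Fin (r + 1), (w / 2) := by
        rw [Finset.prod_const, Finset.card_univ, Fintype.card_fin]
      rw [h2, ← Finset.prod_mul_distrib]
      refine Finset.prod_congr rfl fun k _ => ?_
      rw [node, ← hwdef]
      linarith
    rw [h1, abs_mul, abs_of_pos (by positivity)]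
    have h3 := abs_prod_sub_chebPoint_le hr hy1
    have hh0 : 0 ≤ 𝓜.h := hw.le.trans hwh
    gcongr
  rw [abs_sub_comm, 𝓜.interp_eq _ i hx, ← hj]
  change |v x - ((Lagrange.interpolate Finset.univ (𝓜.node r i j)) fun k =>
    v (𝓜.node r i j k)).eval x| ≤ _
  rw [herr, abs_mul, abs_div, abs_of_pos (by positivity : (0 : ℝ) < (r + 1).factorial)]
  have hγ := cos_chebAngle_pos hr
  calc _ ≤ (E * Real.exp (2 * s * 𝓜.h / χ) * v x) / (r + 1).factorial * ((𝓜.h / 2) ^ (r + 1) *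
      ((1 / Real.cos (Real.pi / (2 * r + 2))) ^ (r + 1) * (1 / 2 ^ r))) :=
        mul_le_mul (by gcongr) hprod (abs_nonneg _)
          (by have := (hpos x hxS).le; positivity)
    _ = _ := by
        rw [constG]
        simp only [div_pow, mul_pow, one_pow]
        field_simp

/-- Distinct interpolation points are uniformly separated. -/
theorem le_abs_sub_of_mem_T {r : ℕ} (hr : 1 ≤ r)
    (hgap : ∀ i i' : Fin I, (i : ℕ) + 1 = i' →
      2 * Real.sin (Real.pi / (2 * r + 2)) ^ 2 * 𝓜.width i ≤ 𝓜.left i' - 𝓜.right i)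
    {ξ η : ℝ} (hξ : ξ ∈ 𝓜.T r) (hη : η ∈ 𝓜.T r) (hne : ξ ≠ η) :
    2 * Real.sin (Real.pi / (2 * r + 2)) ^ 2 * 𝓜.hmin ≤ |ξ - η| := by
  set σ := 2 * Real.sin (Real.pi / (2 * r + 2)) ^ 2 with hσ
  have hσ0 : 0 ≤ σ := by positivity
  have hσ1 : σ ≤ 1 := two_mul_sin_chebAngle_sq_le hr
  have hmin : ∀ i, σ * 𝓜.hmin ≤ σ * 𝓜.width i := fun i =>
    mul_le_mul_of_nonneg_left (𝓜.hmin_le_width i) hσ0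
  have hdist : ∀ i (j : Fin (𝓜.N i)) (k l : Fin (r + 1)), k < l →
      σ * 𝓜.width i ≤ 𝓜.node r i j l - 𝓜.node r i j k := by
    intro i j k l hkl
    have h1 := chebPoint_sub_le hr hkl
    have h2 := 𝓜.width_pos i
    simp only [node]
    nlinarith
  have hI : ∀ i i' (j : Fin (𝓜.N i)) (j' : Fin (𝓜.N i')) (k k' : Fin (r + 1)), i < i' →
      σ * 𝓜.hmin ≤ 𝓜.node r i' j' k' - 𝓜.node r i j k := by
    intro i i' j j' k k' hii
    have h1 := (𝓜.node_mem_Icc hr i j k).2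
    have h2 := (𝓜.node_mem_Icc hr i' j' k').1
    have hlt : (i : ℕ) + 1 ≤ i' := hii
    have h3 := hgap i ⟨i + 1, hlt.trans_lt i'.2⟩ rfl
    have h4 : 𝓜.left ⟨i + 1, hlt.trans_lt i'.2⟩ ≤ 𝓜.left i' := by
      rcases hlt.eq_or_lt with h | h
      · exact le_of_eq (congrArg _ (Fin.ext h))
      · exact ((𝓜.left_lt_right _).trans (𝓜.ordered ⟨i + 1, hlt.trans_lt i'.2⟩ i' h)).le
    linarith [hmin i]
  -- Adjacent cells share an endpoint node. If one of the two points is not the end node facing the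
  -- other cell, its distance to that end node suffices. Otherwise distinctness forces a full cell
  -- between them, and `σ ≤ 1`.
  have hJ : ∀ i (j j' : Fin (𝓜.N i)) (k k' : Fin (r + 1)), j < j' →
      𝓜.node r i j k ≠ 𝓜.node r i j' k' →
      σ * 𝓜.hmin ≤ 𝓜.node r i j' k' - 𝓜.node r i j k := by
    intro i j j' k k' hjj hne
    refine (hmin i).trans ?_
    have hw := 𝓜.width_pos i
    have h1 := (𝓜.node_mem_cell hr i j k).2
    have h2 := (𝓜.node_mem_cell hr i j' k').1
    have hjj' : (j : ℝ) + 1 ≤ j' := by exact_mod_cast hjj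
    have hlast : 𝓜.node r i j (Fin.last r) = 𝓜.left i + ((j : ℝ) + 1) * 𝓜.width i := by
      rw [node, chebPoint_last hr]; ring
    have hfirst : 𝓜.node r i j' 0 = 𝓜.left i + (j' : ℝ) * 𝓜.width i := by
      rw [node, chebPoint_zero hr]; ring
    have h3 : ((j : ℝ) + 1) * 𝓜.width i ≤ (j' : ℝ) * 𝓜.width i := by gcongr
    rcases (Fin.le_last k).lt_or_eq with hk | hk
    · linarith [hdist i j k _ hk]
    rcases (Fin.zero_le k').lt_or_eq with hk' | hk'
    · linarith [hdist i j' 0 k' hk']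
    subst hk hk'
    have h4 : (j : ℕ) + 1 ≠ j' := by
      intro h
      refine hne ?_
      rw [hlast, hfirst, ← h]
      push_cast
      ring
    have h5 : (j : ℕ) + 2 ≤ j' := by
      have : (j : ℕ) + 1 ≤ j' := hjj
      omega
    have h6 : (j : ℝ) + 2 ≤ j' := by exact_mod_cast h5
    have h7 : ((j : ℝ) + 2) * 𝓜.width i ≤ (j' : ℝ) * 𝓜.width i := by gcongr
    have h8 : σ * 𝓜.width i ≤ 1 * 𝓜.width i := by gcongr
    rw [hlast, hfirst]
    linarith
  obtain ⟨⟨i, j, k⟩, -, rfl⟩ := Finset.mem_image.1 hξ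
  obtain ⟨⟨i', j', k'⟩, -, rfl⟩ := Finset.mem_image.1 hη
  simp only at hne ⊢
  rcases lt_trichotomy i i' with h | h | h
  · rw [abs_sub_comm]
    exact (hI i i' j j' k k' h).trans (le_abs_self _)
  · subst h
    rcases lt_trichotomy j j' with h | h | h
    · rw [abs_sub_comm]
      exact (hJ i j j' k k' h hne).trans (le_abs_self _)
    · subst h
      rcases lt_trichotomy k k' with h | h | h
      · rw [abs_sub_comm]
        exact ((hmin i).trans (hdist i j k k' h)).trans (le_abs_self _)
      · exact absurd (by rw [h]) hne
      · exact ((hmin i).trans (hdist i j k' k h)).trans (le_abs_self _)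
    · exact (hJ i j' j k' k h hne.symm).trans (le_abs_self _)
  · exact (hI i' i j' j k' k h).trans (le_abs_self _)

theorem T_subset_Icc {a b : ℝ} {r : ℕ} (hr : 1 ≤ r)
    (h : ∀ i, Set.Icc (𝓜.left i) (𝓜.right i) ⊆ Set.Icc a b) {ξ : ℝ} (hξ : ξ ∈ 𝓜.T r) :
    ξ ∈ Set.Icc a b := by
  obtain ⟨⟨i, j, k⟩, -, rfl⟩ := Finset.mem_image.1 hξ
  exact h i (𝓜.node_mem_Icc hr i j k)

theorem nontrivial_T [Nonempty (Fin I)] {r : ℕ} (hr : 1 ≤ r) : Nontrivial (𝓜.T r) := by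
  let i : Fin I := Classical.arbitrary _
  let j : Fin (𝓜.N i) := ⟨0, 𝓜.N_pos i⟩
  refine ⟨⟨_, 𝓜.node_mem_T r i j 0⟩, ⟨_, 𝓜.node_mem_T r i j (Fin.last r)⟩, fun h => ?_⟩
  have h1 := 𝓜.node_injective hr i j (Subtype.mk.inj h)
  have h2 := congrArg Fin.val h1
  rw [Fin.val_zero, Fin.val_last] at h2
  omega

end IntervalMesh

/-! ## Spectral radius estimates from an invariant cone -/

section Cone

theorem pow_apply_mem_of_mapsTo {E : Type*} [AddCommGroup E] [Module ℝ E] {A : E →ₗ[ℝ] E} {K : Set E}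
    (hA : ∀ F ∈ K, A F ∈ K) (k : ℕ) {F : E} (hF : F ∈ K) :
    (A ^ k) F ∈ K := by
  induction k with
  | zero => simpa
  | succ k ih => rw [pow_succ', Module.End.mul_apply]; exact hA _ ih

variable {ι : Type*} [Fintype ι] [DecidableEq ι]

attribute [local instance] Matrix.linftyOpNormedRing Matrix.linftyOpNormedAlgebra

theorem toMatrix'_map_pow (A : (ι → ℝ) →ₗ[ℝ] (ι → ℝ)) (k : ℕ) :
    (LinearMap.toMatrix' A).map (algebraMap ℝ ℂ) ^ k =
      (LinearMap.toMatrix' (A ^ k)).map (algebraMap ℝ ℂ) := by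
  have h : LinearMap.toMatrix' (A ^ k) = LinearMap.toMatrix' A ^ k :=
    map_pow (LinearMap.toMatrixAlgEquiv' : ((ι → ℝ) →ₗ[ℝ] (ι → ℝ)) ≃ₐ[ℝ] Matrix ι ι ℝ) A k
  rw [h]
  exact (map_pow (algebraMap ℝ ℂ).mapMatrix _ k).symm

/-- Growth of a single coordinate along one orbit bounds the norms of the powers from below. The
sup-norm operator norm serves only Gelfand's formula; the spectral radius does not depend on it. -/
theorem le_matrixSpectralRadius_of_forall (A : (ι → ℝ) →ₗ[ℝ] (ι → ℝ)) {V : ι → ℝ} {c : ℝ}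
    (hc : 0 ≤ c) (i : ι) (hi : 0 < V i) (h : ∀ k : ℕ, c ^ k * V i ≤ (A ^ k) V i) :
    c ≤ matrixSpectralRadius A := by
  set W : ι → ℂ := fun j => (V j : ℂ) with hW
  have hWpos : 0 < ‖W‖ := by
    refine lt_of_lt_of_le ?_ (norm_le_pi_norm W i)
    simpa [hW] using hi.ne'
  refine le_spectralRadius_of_frequently (a := (LinearMap.toMatrix' A).map (algebraMap ℝ ℂ))
    (div_pos hi hWpos) hc (Frequently.of_forall fun k => ?_)
  rw [div_mul_eq_mul_div, div_le_iff₀ hWpos, toMatrix'_map_pow]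
  refine le_trans ?_ (Matrix.linfty_opNorm_mulVec _ _)
  refine le_trans ?_ (norm_le_pi_norm _ i)
  have h1 : ((LinearMap.toMatrix' (A ^ k)).map (algebraMap ℝ ℂ)).mulVec W i =
      (((A ^ k) V i : ℝ) : ℂ) := by
    rw [← LinearMap.toMatrix'_mulVec]
    simp [Matrix.mulVec, dotProduct, hW]
  rw [h1, Complex.norm_real, mul_comm]
  exact (h k).trans (le_abs_self _)

theorem matrixSpectralRadius_le_of_forall (A : (ι → ℝ) →ₗ[ℝ] (ι → ℝ)) {c D : ℝ} (hc : 0 ≤ c)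
    (hD : 0 < D) (h : ∀ (k : ℕ) (i j : ι), |(A ^ k) (Pi.single j 1) i| ≤ D * c ^ k) :
    matrixSpectralRadius A ≤ c := by
  refine spectralRadius_le_of_forall (a := (LinearMap.toMatrix' A).map (algebraMap ℝ ℂ))
    -- The `+ 1` keeps the constant positive even for empty `ι`.
    (c := (Fintype.card ι + 1) * D) (by positivity) hc fun k => ?_
  rw [toMatrix'_map_pow, Matrix.linfty_opNorm_def]
  have hnn : 0 ≤ (Fintype.card ι + 1) * D * c ^ k := by positivity
  rw [← NNReal.coe_mk _ hnn, NNReal.coe_le_coe]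
  refine Finset.sup_le fun i _ => ?_
  rw [← NNReal.coe_le_coe, NNReal.coe_sum, NNReal.coe_mk]
  calc _ ≤ ∑ _j : ι, D * c ^ k := by
        refine Finset.sum_le_sum fun j _ => ?_
        rw [coe_nnnorm, Matrix.map_apply, LinearMap.toMatrix'_apply]
        simp only [Complex.coe_algebraMap, Complex.norm_real, Real.norm_eq_abs]
        exact h k i j
    _ = Fintype.card ι * (D * c ^ k) := by
        rw [Finset.sum_const, Finset.card_univ, nsmul_eq_mul]
    _ ≤ _ := by nlinarith [mul_nonneg hD.le (pow_nonneg hc k)]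

theorem matrixSpectralRadius_nonneg (A : (ι → ℝ) →ₗ[ℝ] (ι → ℝ)) : 0 ≤ matrixSpectralRadius A :=
  ENNReal.toReal_nonneg

variable {A : (ι → ℝ) →ₗ[ℝ] (ι → ℝ)} {K : Set (ι → ℝ)}

/-- In the order defined by `K`, preserved by `A`, the relation `A V ≥ c V` iterates to `A^k V ≥ c^k
V`; nonnegativity of cone elements makes this pointwise. -/
theorem le_matrixSpectralRadius_of_cone (hA : ∀ F ∈ K, A F ∈ K) (h0 : (0 : ι → ℝ) ∈ K)
    (hadd : ∀ F ∈ K, ∀ F' ∈ K, F + F' ∈ K) (hsmul : ∀ x : ℝ, 0 ≤ x → ∀ F ∈ K, x • F ∈ K)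
    (hnn : ∀ F ∈ K, ∀ i, 0 ≤ F i) {V : ι → ℝ} {c : ℝ} (hc : 0 ≤ c) (i : ι) (hi : 0 < V i)
    (h : A V - c • V ∈ K) : c ≤ matrixSpectralRadius A := by
  have hk : ∀ k : ℕ, (A ^ k) V - c ^ k • V ∈ K := by
    intro k
    induction k with
    | zero => simpa using h0
    | succ k ih =>
      have h1 : (A ^ (k + 1)) V - c ^ (k + 1) • V =
          A ((A ^ k) V - c ^ k • V) + c ^ k • (A V - c • V) := by
        rw [pow_succ', Module.End.mul_apply, map_sub, map_smul, smul_sub, smul_smul, pow_succ]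
        abel
      rw [h1]
      exact hadd _ (hA _ ih) _ (hsmul _ (pow_nonneg hc k) _ h)
  refine le_matrixSpectralRadius_of_forall A hc i hi fun k => ?_
  have := hnn _ (hk k) i
  simp only [Pi.sub_apply, Pi.smul_apply, smul_eq_mul] at this
  linarith

/-- Here one orbit is not enough: `hunit` bounds each unit vector by `C V` in the cone order, so
`|A^k e_j| ≤ C A^k V ≤ C c^k V` controls all matrix entries. -/
theorem matrixSpectralRadius_le_of_cone (hA : ∀ F ∈ K, A F ∈ K) (h0 : (0 : ι → ℝ) ∈ K)
    (hadd : ∀ F ∈ K, ∀ F' ∈ K, F + F' ∈ K) (hsmul : ∀ x : ℝ, 0 ≤ x → ∀ F ∈ K, x • F ∈ K)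
    (hnn : ∀ F ∈ K, ∀ i, 0 ≤ F i) {V : ι → ℝ} {c C : ℝ} (hc : 0 ≤ c) (hC : 0 ≤ C)
    (hunit : ∀ j, C • V + Pi.single j 1 ∈ K ∧ C • V - Pi.single j 1 ∈ K)
    (h : c • V - A V ∈ K) : matrixSpectralRadius A ≤ c := by
  have hk : ∀ k : ℕ, c ^ k • V - (A ^ k) V ∈ K := by
    intro k
    induction k with
    | zero => simpa using h0
    | succ k ih =>
      have h1 : c ^ (k + 1) • V - (A ^ (k + 1)) V =
          A (c ^ k • V - (A ^ k) V) + c ^ k • (c • V - A V) := by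
        rw [pow_succ' A, Module.End.mul_apply, map_sub, map_smul, smul_sub, smul_smul, pow_succ]
        abel
      rw [h1]
      exact hadd _ (hA _ ih) _ (hsmul _ (pow_nonneg hc k) _ h)
  refine matrixSpectralRadius_le_of_forall A (D := C * ‖V‖ + 1) hc (by positivity) fun k i j => ?_
  have h1 := hnn _ (pow_apply_mem_of_mapsTo hA k (hunit j).1) i
  have h2 := hnn _ (pow_apply_mem_of_mapsTo hA k (hunit j).2) i
  have h3 := hnn _ (hk k) i
  simp only [map_add, map_sub, map_smul, Pi.add_apply, Pi.sub_apply, Pi.smul_apply,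
    smul_eq_mul] at h1 h2 h3
  have h4 : V i ≤ ‖V‖ := (le_abs_self _).trans (norm_le_pi_norm V i)
  have h5 : (A ^ k) V i ≤ c ^ k * ‖V‖ :=
    (sub_nonneg.1 h3).trans (mul_le_mul_of_nonneg_left h4 (pow_nonneg hc k))
  have h6 := mul_le_mul_of_nonneg_left h5 hC
  have h7 := pow_nonneg hc k
  rw [abs_le]
  constructor <;> nlinarith

end Cone

/-- With `y = 2ε / (1 - ε²)` one has `(1 + y + yε)(1 - ε) = 1 + ε` exactly, and `yε ≤ y²/2` because
`2ε ≤ y`; so the quadratic lower bound for `exp` suffices. -/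
theorem one_add_div_one_sub_le_exp {ε : ℝ} (h0 : 0 ≤ ε) (h1 : ε < 1) :
    (1 + ε) / (1 - ε) ≤ Real.exp (2 * ε / (1 - ε ^ 2)) := by
  have h2 : 0 < 1 - ε := by linarith
  have h3 : 0 < 1 - ε ^ 2 := by nlinarith
  refine le_trans ?_ (Real.quadratic_le_exp_of_nonneg (by positivity))
  set y := 2 * ε / (1 - ε ^ 2) with hy
  have hy0 : 0 ≤ y := by positivity
  have h4 : y * (1 - ε ^ 2) = 2 * ε := div_mul_cancel₀ _ h3.ne'
  have h5 : 2 * ε ≤ y := by nlinarith [mul_nonneg hy0 (sq_nonneg ε)]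
  rw [div_le_iff₀ h2]
  have h6 : y * ε ≤ y ^ 2 / 2 := by nlinarith
  nlinarith [mul_le_mul_of_nonneg_right h6 h2.le]

/-! ### Membership in the cone `K(M; T)`. -/

namespace IntervalMesh

variable {I : ℕ} (𝓜 : IntervalMesh I) {r : ℕ} {M : ℝ}

theorem zero_mem_cone : (0 : 𝓜.T r → ℝ) ∈ 𝓜.cone r M := fun ξ η => by simp

theorem add_mem_cone {F F' : 𝓜.T r → ℝ} (hF : F ∈ 𝓜.cone r M) (hF' : F' ∈ 𝓜.cone r M) :
    F + F' ∈ 𝓜.cone r M := fun ξ η => by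
  have h1 := hF ξ η
  have h2 := hF' ξ η
  simp only [Pi.add_apply]
  linarith

theorem smul_mem_cone {x : ℝ} (hx : 0 ≤ x) {F : 𝓜.T r → ℝ} (hF : F ∈ 𝓜.cone r M) :
    x • F ∈ 𝓜.cone r M := fun ξ η => by
  have h1 := mul_le_mul_of_nonneg_left (hF ξ η) hx
  simp only [Pi.smul_apply, smul_eq_mul]
  linarith

/-- Going from `ξ` to another point and back gives `F ξ ≤ e² F ξ` with `e > 1`. A second point of
`T` is essential. -/
theorem nonneg_of_mem_cone [Nontrivial (𝓜.T r)] (hM : 0 < M) {F : 𝓜.T r → ℝ}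
    (hF : F ∈ 𝓜.cone r M) (ξ : 𝓜.T r) : 0 ≤ F ξ := by
  obtain ⟨η, hη⟩ := exists_ne ξ
  have hd : 0 < |(ξ : ℝ) - η| := abs_pos.2 (sub_ne_zero.2 fun h => hη (Subtype.ext h).symm)
  have h1 := hF ξ η
  have h2 := hF η ξ
  rw [abs_sub_comm] at h2
  have h3 : 1 < Real.exp (M * |(ξ : ℝ) - η|) := Real.one_lt_exp_iff.2 (by positivity)
  set e := Real.exp (M * |(ξ : ℝ) - η|)
  have h4 : F ξ ≤ e * (e * F ξ) := h1.trans (mul_le_mul_of_nonneg_left h2 (by linarith))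
  by_contra! hneg
  nlinarith [mul_pos (sub_pos.2 h3) (neg_pos.2 hneg)]

theorem cone_mono [Nontrivial (𝓜.T r)] {M' : ℝ} (hM' : 0 < M') (h : M' ≤ M) :
    𝓜.cone r M' ⊆ 𝓜.cone r M := fun F hF ξ η => by
  refine (hF ξ η).trans (mul_le_mul_of_nonneg_right ?_ (𝓜.nonneg_of_mem_cone hM' hF η))
  gcongr

/-- Functions which are relatively close to a log-Lipschitz positive function lie in a cone. -/
theorem mem_cone_of_abs_sub_le {L ε δ : ℝ} {V U : 𝓜.T r → ℝ} (hV : ∀ ξ, 0 < V ξ)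
    (hVL : ∀ ξ η : 𝓜.T r, V ξ ≤ V η * Real.exp (L * |(ξ : ℝ) - η|))
    (h0 : 0 ≤ ε) (h1 : ε < 1) (hU : ∀ ξ, |U ξ - V ξ| ≤ ε * V ξ) (hδ : 0 < δ)
    (hsep : ∀ ξ η : 𝓜.T r, ξ ≠ η → δ ≤ |(ξ : ℝ) - η|)
    (hM : L + 2 * ε / (1 - ε ^ 2) / δ ≤ M) : U ∈ 𝓜.cone r M := by
  intro ξ η
  rcases eq_or_ne ξ η with rfl | hne
  · simp
  set d := |(ξ : ℝ) - η|
  have hd : δ ≤ d := hsep ξ η hne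
  have hε : 0 < 1 - ε := by linarith
  have h3 : 0 < 1 - ε ^ 2 := by nlinarith
  have h4 : (1 + ε) / (1 - ε) ≤ Real.exp ((M - L) * d) := by
    refine (one_add_div_one_sub_le_exp h0 h1).trans (Real.exp_le_exp.2 ?_)
    have h5 : 2 * ε / (1 - ε ^ 2) / δ ≤ M - L := by linarith
    calc 2 * ε / (1 - ε ^ 2) = 2 * ε / (1 - ε ^ 2) / δ * δ := by field_simp
      _ ≤ (M - L) * d := mul_le_mul h5 hd hδ.le (le_trans (by positivity) h5)
  have h6 : Real.exp (M * d) = Real.exp ((M - L) * d) * Real.exp (L * d) := by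
    rw [← Real.exp_add]; ring_nf
  have hξ := (abs_le.1 (hU ξ)).2
  have hη := (abs_le.1 (hU η)).1
  rw [div_le_iff₀ hε] at h4
  calc U ξ ≤ (1 + ε) * V ξ := by linarith
    _ ≤ (1 + ε) * (V η * Real.exp (L * d)) := by gcongr; exact hVL ξ η
    _ ≤ (Real.exp ((M - L) * d) * (1 - ε)) * (V η * Real.exp (L * d)) :=
        mul_le_mul_of_nonneg_right h4 (mul_pos (hV η) (Real.exp_pos _)).le
    _ = Real.exp (M * d) * ((1 - ε) * V η) := by rw [h6]; ring
    _ ≤ Real.exp (M * d) * U η := by gcongr; linarith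

/-- Strictly positive elements of `K(M'; T)` are interior points of `K(M; T)` if `M' < M`. -/
theorem exists_smul_add_single_mem_cone {M' : ℝ} (hM' : M' < M) {W : 𝓜.T r → ℝ}
    (hW : W ∈ 𝓜.cone r M') (hpos : ∀ ξ, 0 < W ξ) :
    ∃ C : ℝ, 0 ≤ C ∧ ∀ j, C • W + Pi.single j 1 ∈ 𝓜.cone r M ∧
      C • W - Pi.single j 1 ∈ 𝓜.cone r M := by
  -- The slack of `C • W` in the cone inequality for `M` grows linearly in `C`, while a perturbation
  -- bounded by `1` uses at most `1 + e^(M d)`, where `d` is the distance of the pair. There are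
  -- finitely many pairs.
  have hev : ∀ᶠ C : ℝ in atTop, 0 ≤ C ∧ ∀ ξ η : 𝓜.T r, ξ ≠ η → 1 + Real.exp (M * |(ξ : ℝ) - η|) ≤
      C * (W η * (Real.exp (M * |(ξ : ℝ) - η|) - Real.exp (M' * |(ξ : ℝ) - η|))) := by
    refine (eventually_ge_atTop 0).and (eventually_all.2 fun ξ => eventually_all.2 fun η => ?_)
    by_cases hne : ξ = η
    · exact Eventually.of_forall fun C h => absurd hne h
    have hd : 0 < |(ξ : ℝ) - η| := abs_pos.2 (sub_ne_zero.2 fun h => hne (Subtype.ext h))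
    have h1 : 0 < W η * (Real.exp (M * |(ξ : ℝ) - η|) - Real.exp (M' * |(ξ : ℝ) - η|)) :=
      mul_pos (hpos η) (sub_pos.2 (Real.exp_lt_exp.2 (mul_lt_mul_of_pos_right hM' hd)))
    exact ((tendsto_id.atTop_mul_const h1).eventually_ge_atTop _).mono fun C hC _ => hC
  obtain ⟨C, hC0, hC⟩ := hev.exists
  have key : ∀ S : 𝓜.T r → ℝ, (∀ ξ, |S ξ| ≤ 1) → C • W + S ∈ 𝓜.cone r M := by
    intro S hS ξ η
    rcases eq_or_ne ξ η with rfl | hne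
    · simp
    have h1 := hC ξ η hne
    have h2 := mul_le_mul_of_nonneg_left (hW ξ η) hC0
    have h3 := (abs_le.1 (hS ξ)).2
    have h4 := (abs_le.1 (hS η)).1
    have h5 := Real.exp_pos (M * |(ξ : ℝ) - η|)
    simp only [Pi.add_apply, Pi.smul_apply, smul_eq_mul]
    nlinarith [mul_le_mul_of_nonneg_left h4 h5.le]
  have hs : ∀ j ξ : 𝓜.T r, |(Pi.single j 1 : 𝓜.T r → ℝ) ξ| ≤ 1 := by
    intro j ξ
    by_cases h : ξ = j
    · subst h; simp
    · simp [h]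
  refine ⟨C, hC0, fun j => ⟨key _ (hs j), ?_⟩⟩
  rw [sub_eq_add_neg]
  exact key _ fun ξ => by rw [Pi.neg_apply, abs_neg]; exact hs j ξ

end IntervalMesh

/-- The discrete operator applied to the values of the eigenfunction. -/
theorem abs_discreteOp_sub_le {a b : ℝ} (hab : a < b) {n : ℕ} {Φ : WeightedIFS a b n} {r : ℕ}
    (hr : 1 ≤ r) {s : ℝ} (hs : 0 < s) {ν : ℕ} {I : ℕ} {𝓜 : IntervalMesh I}
    (habs : MeshAbsorbs Φ 𝓜 ν) {E χ : ℝ} (hχ : 0 < χ) {v : ℝ → ℝ}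
    (hv : Φ.IsPosEigenfunction s (r + 1) v)
    (hv₁ : ∀ x ∈ Set.Icc a b, |iteratedDerivWithin (r + 1) v (Set.Icc a b) x| / v x ≤ E)
    (hv₂ : ∀ x₁ ∈ Set.Icc a b, ∀ x₂ ∈ Set.Icc a b, v x₁ ≤ v x₂ * Real.exp (2 * s * |x₁ - x₂| / χ))
    (ξ : 𝓜.T r) :
    |discreteOp Φ 𝓜 r s ν (fun ξ => v ξ) ξ - Φ.lam s ^ ν * v ξ| ≤
      constG r s E χ 𝓜.h * 𝓜.h ^ (r + 1) * (Φ.lam s ^ ν * v ξ) := by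
  have hξ : (ξ : ℝ) ∈ Set.Icc a b := 𝓜.T_subset_Icc hr habs.1 ξ.2
  -- Writing `Λ v(ξ)` as a sum over words puts both sides in the same form, so the relative
  -- interpolation error is applied word by word.
  rw [← hv.sum_word ν hξ, Finset.mul_sum]
  change |∑ ω : Fin ν → Fin n, Φ.gWord (List.ofFn ω) ξ ^ s *
    𝓜.interp r (fun ξ => v ξ) (Φ.thetaWord (List.ofFn ω) ξ) - _| ≤ _
  rw [← Finset.sum_sub_distrib]
  refine (Finset.abs_sum_le_sum_abs _ _).trans (Finset.sum_le_sum fun ω _ => ?_)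
  obtain ⟨i, hi⟩ := habs.2 ω
  have h1 := 𝓜.abs_interp_sub_le hab hr hs hχ hv.1 hv.2.1 hv₁ hv₂ i (habs.1 i) (hi hξ)
  have h2 : 0 ≤ Φ.gWord (List.ofFn ω) ξ ^ s := Real.rpow_nonneg (Φ.gWord_pos _ hξ).le _
  rw [← mul_sub, abs_mul, abs_of_nonneg h2, mul_left_comm]
  exact mul_le_mul_of_nonneg_left h1 h2

end

/-! ### The spectral radius estimate. -/

theorem theorem6p5 {a b : ℝ} (hab : a < b) {n : ℕ} (hn : 0 < n) (Φ : WeightedIFS a b n)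
    (hcontr : Φ.EventuallyContracting)
    (r : ℕ) (hr : 1 ≤ r)
    (hθ : ∀ p, ContDiffOn ℝ ((r + 1 : ℕ) : WithTop ℕ∞) (Φ.θ p) (Set.Icc a b))
    (hg : ∀ p, ContDiffOn ℝ ((r + 1 : ℕ) : WithTop ℕ∞) (Φ.g p) (Set.Icc a b))
    (s : ℝ) (hs : 0 < s) (ν : ℕ) (hν : 1 ≤ ν)
    {I : ℕ} (𝓜 : IntervalMesh I) (habs : MeshAbsorbs Φ 𝓜 ν)
    (hgap : ∀ i i' : Fin I, (i : ℕ) + 1 = i' →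
      2 * Real.sin (Real.pi / (2 * r + 2)) ^ 2 * 𝓜.width i ≤ 𝓜.left i' - 𝓜.right i)
    (E χ : ℝ) (hχ : 0 < χ)
    -- the two estimates for the positive eigenfunction (which is unique up to a scalar factor)
    (hv₁ : ∀ v : ℝ → ℝ, Φ.IsPosEigenfunction s (r + 1) v → ∀ x ∈ Set.Icc a b,
      |iteratedDerivWithin (r + 1) v (Set.Icc a b) x| / v x ≤ E)
    (hv₂ : ∀ v : ℝ → ℝ, Φ.IsPosEigenfunction s (r + 1) v →
      ∀ x₁ ∈ Set.Icc a b, ∀ x₂ ∈ Set.Icc a b,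
        v x₁ ≤ v x₂ * Real.exp (2 * s * |x₁ - x₂| / χ))
    (G : ℝ) (hG : G = constG r s E χ 𝓜.h) (hGh : G * 𝓜.h ^ (r + 1) < 1)
    (H : ℝ) (hH : G < H) (hh : 𝓜.h < 1)
    (M M' : ℝ) (hM' : 0 < M') (hM'M : M' < M) (hM₂ : constM₂ r s χ 𝓜.h 𝓜.mu G H ≤ M)
    (hinv : ∀ F ∈ 𝓜.cone r M, discreteOp Φ 𝓜 r s ν F ∈ 𝓜.cone r M') :
    Φ.lam s ^ ν * (1 - H * 𝓜.h ^ r) ≤ matrixSpectralRadius (discreteOp Φ 𝓜 r s ν) ∧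
      matrixSpectralRadius (discreteOp Φ 𝓜 r s ν) ≤ Φ.lam s ^ ν * (1 + H * 𝓜.h ^ r) := by
  have hI : Nonempty (Fin I) := by
    obtain ⟨i, -⟩ := habs.2 fun _ => ⟨0, hn⟩
    exact ⟨i⟩
  have hT : Nontrivial (𝓜.T r) := 𝓜.nontrivial_T hr
  obtain ⟨v, hv⟩ := hcontr.exists_isPosEigenfunction hab hn hs.le (r + 1) hθ hg
  have hv₁' := hv₁ v hv
  have hv₂' := hv₂ v hv
  have hlam : 0 < Φ.lam s := (hcontr.exists_partitionSum_bounds hab hn hs.le).1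
  set Λ := Φ.lam s ^ ν with hΛdef
  have hΛ : 0 < Λ := pow_pos hlam ν
  have hhpos : 0 < 𝓜.h := 𝓜.h_pos
  have hhmin : 0 < 𝓜.hmin := 𝓜.hmin_pos
  have haS : a ∈ Set.Icc a b := Set.left_mem_Icc.2 hab.le
  have hE : 0 ≤ E := (div_nonneg (abs_nonneg _) (hv.2.1 a haS).le).trans (hv₁' a haS)
  have hG0 : 0 ≤ G := by
    have := cos_chebAngle_pos hr
    rw [hG, constG]
    positivity
  have hH0 : 0 < H := hG0.trans_lt hH
  have hM : 0 < M := hM'.trans hM'M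
  have hσ := sin_chebAngle_pos r
  set A := discreteOp Φ 𝓜 r s ν with hA
  set V : 𝓜.T r → ℝ := fun ξ => v ξ with hVdef
  have hVpos : ∀ ξ, 0 < V ξ := fun ξ => hv.2.1 _ (𝓜.T_subset_Icc hr habs.1 ξ.2)
  have hVL : ∀ ξ η : 𝓜.T r, V ξ ≤ V η * Real.exp (2 * s / χ * |(ξ : ℝ) - η|) := fun ξ η => by
    rw [div_mul_eq_mul_div]
    exact hv₂' _ (𝓜.T_subset_Icc hr habs.1 ξ.2) _ (𝓜.T_subset_Icc hr habs.1 η.2)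
  have hAV : ∀ ξ, |A V ξ - Λ * V ξ| ≤ G * 𝓜.h ^ (r + 1) * (Λ * V ξ) := fun ξ => by
    rw [hG]
    exact abs_discreteOp_sub_le hab hr hs habs hχ hv hv₁' hv₂' ξ
  -- The ratio of the error `G h^(r+1)` to the margin `H h^r`.
  set ε := G / H * 𝓜.h with hε
  have hGH : G / H < 1 := (div_lt_one hH0).2 hH
  have hGH0 : 0 ≤ G / H := div_nonneg hG0 hH0.le
  have hε0 : 0 ≤ ε := by positivity
  have hε1 : ε < 1 := by nlinarith
  have hε2 : 0 < 1 - ε ^ 2 := by nlinarith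
  set δ := 2 * Real.sin (Real.pi / (2 * r + 2)) ^ 2 * 𝓜.hmin with hδ
  have hδ0 : 0 < δ := by positivity
  have hsep : ∀ ξ η : 𝓜.T r, ξ ≠ η → δ ≤ |(ξ : ℝ) - η| := fun ξ η hne =>
    𝓜.le_abs_sub_of_mem_T hr hgap ξ.2 η.2 fun h => hne (Subtype.ext h)
  have hMbig : 2 * s / χ + 2 * ε / (1 - ε ^ 2) / δ ≤ M := by
    refine le_trans ?_ hM₂
    have h1 : 2 * ε / (1 - ε ^ 2) / δ =
        G / H * (𝓜.mu / (1 - ε ^ 2)) * (1 / Real.sin (Real.pi / (2 * r + 2)) ^ 2) := by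
      rw [hδ, IntervalMesh.mu]
      nth_rewrite 1 [hε]
      field_simp
    -- Only the second summand of `M₁` is needed; the first is nonnegative because `G h^(r+1) < 1`.
    have h2 : 2 * s / χ ≤ constM₁ r s χ 𝓜.h 𝓜.mu G := by
      have h3 : 0 ≤ 1 - G ^ 2 * 𝓜.h ^ (2 * r + 2) := by
        have h4 : G ^ 2 * 𝓜.h ^ (2 * r + 2) = (G * 𝓜.h ^ (r + 1)) ^ 2 := by ring
        have h5 : 0 ≤ G * 𝓜.h ^ (r + 1) := by positivity
        rw [h4]
        nlinarith
      have h6 : 0 ≤ 𝓜.mu := div_nonneg hhpos.le hhmin.le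
      rw [constM₁]
      exact le_add_of_nonneg_left (by positivity)
    rw [h1, constM₂]
    linarith
  have hscaled : ∀ U : 𝓜.T r → ℝ,
      (∀ ξ, |U ξ - Λ * (H * 𝓜.h ^ r) * V ξ| ≤ G * 𝓜.h ^ (r + 1) * (Λ * V ξ)) →
      U ∈ 𝓜.cone r M := by
    intro U hU
    have hk : 0 < Λ * (H * 𝓜.h ^ r) := by positivity
    refine 𝓜.mem_cone_of_abs_sub_le (V := fun ξ => Λ * (H * 𝓜.h ^ r) * V ξ) (L := 2 * s / χ)
      (fun ξ => mul_pos hk (hVpos ξ)) (fun ξ η => ?_) hε0 hε1 (fun ξ => (hU ξ).trans_eq ?_)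
      hδ0 hsep hMbig
    · exact (mul_le_mul_of_nonneg_left (hVL ξ η) hk.le).trans_eq (mul_assoc _ _ _).symm
    · rw [hε, pow_succ]
      field_simp
  have hVcone : V ∈ 𝓜.cone r M := by
    refine 𝓜.mem_cone_of_abs_sub_le hVpos hVL hε0 hε1 (fun ξ => ?_) hδ0 hsep hMbig
    rw [sub_self, abs_zero]
    exact mul_nonneg hε0 (hVpos ξ).le
  have hup : (Λ * (1 + H * 𝓜.h ^ r)) • V - A V ∈ 𝓜.cone r M := by
    refine hscaled _ fun ξ => ?_
    rw [abs_sub_comm]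
    refine le_of_eq_of_le (congrArg _ ?_) (hAV ξ)
    simp only [Pi.sub_apply, Pi.smul_apply, smul_eq_mul]
    ring
  have hlow : A V - (Λ * (1 - H * 𝓜.h ^ r)) • V ∈ 𝓜.cone r M := by
    refine hscaled _ fun ξ => ?_
    refine le_of_eq_of_le (congrArg _ ?_) (hAV ξ)
    simp only [Pi.sub_apply, Pi.smul_apply, smul_eq_mul]
    ring
  have hAcone : ∀ F ∈ 𝓜.cone r M, A F ∈ 𝓜.cone r M := fun F hF =>
    𝓜.cone_mono hM' hM'M.le (hinv F hF)
  have hadd : ∀ F ∈ 𝓜.cone r M, ∀ F' ∈ 𝓜.cone r M, F + F' ∈ 𝓜.cone r M :=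
    fun F hF F' hF' => 𝓜.add_mem_cone hF hF'
  have hsmul : ∀ x : ℝ, 0 ≤ x → ∀ F ∈ 𝓜.cone r M, x • F ∈ 𝓜.cone r M :=
    fun x hx F hF => 𝓜.smul_mem_cone hx hF
  have hnn : ∀ F ∈ 𝓜.cone r M, ∀ ξ, 0 ≤ F ξ := fun F hF ξ => 𝓜.nonneg_of_mem_cone hM hF ξ
  obtain ⟨ξ₀⟩ : Nonempty (𝓜.T r) := inferInstance
  refine ⟨?_, ?_⟩
  -- The cone argument needs a nonnegative factor; a nonpositive one is a trivial lower bound.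
  · rcases le_total 0 (Λ * (1 - H * 𝓜.h ^ r)) with hc | hc
    · exact le_matrixSpectralRadius_of_cone hAcone 𝓜.zero_mem_cone hadd hsmul hnn hc ξ₀
        (hVpos ξ₀) hlow
    · exact hc.trans (matrixSpectralRadius_nonneg _)
  · have hAVpos : ∀ ξ, 0 < A V ξ := fun ξ => by
      have h1 := (abs_le.1 (hAV ξ)).1
      have h2 : 0 < Λ * V ξ := mul_pos hΛ (hVpos ξ)
      nlinarith [mul_pos (sub_pos.2 hGh) h2]
    have hc : 0 ≤ Λ * (1 + H * 𝓜.h ^ r) := by positivity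
    -- Since `A V` lies in `K(M'; T)` and is strictly positive, it is an interior point of `K(M;
    -- T)`. With `c = Λ (1 + H h^r)`, the decomposition `C c V ± e_j = C (c V - A V) + (C A V ±
    -- e_j)` transfers the domination of unit vectors to `V`.
    obtain ⟨C, hC0, hC⟩ := 𝓜.exists_smul_add_single_mem_cone hM'M (hinv V hVcone) hAVpos
    refine matrixSpectralRadius_le_of_cone hAcone 𝓜.zero_mem_cone hadd hsmul hnn hc
      (C := C * (Λ * (1 + H * 𝓜.h ^ r))) (by positivity) (fun j => ?_) hup
    have h1 := hsmul C hC0 _ hup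
    refine ⟨?_, ?_⟩
    · convert hadd _ h1 _ (hC j).1 using 1
      rw [smul_sub, smul_smul]
      abel
    · convert hadd _ h1 _ (hC j).2 using 1
      rw [smul_sub, smul_smul]
      abel
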